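/- Fix $\rho\in(0,1)$ and let $P_{XY}$ be the doubly symmetric binary distribution on $\{0,1\}^2$ with correlation $\rho$, i.e. $P_{XY}(0,0)=P_{XY}(1,1)=\frac{1+\rho}{4}$ and $P_{XY}(0,1)=P_{XY}(1,0)=\frac{1-\rho}{4}$. All logarithms have base $2$, and $D(Q\|P)=\sum_x Q(x)\log\frac{Q(x)}{P(x)}$ denotes relative entropy (with $0\log 0=0$). For $a,b\in[0,1]$ let $$D_2(a)=D\big((a,1-a)\,\|\,P_X\big)=1-H_2(a),\qquad H_2(a)=-a\log a-(1-a)\log(1-a),$$ $$\mathbb D_2(a,b)=\min_{\max(0,a+b-1)\le p\le\min(a,b)} D\left(\begin{bmatrix}1+p-a-b & b-p\\ a-p & p\end{bmatrix}\Big\|\,P_{XY}\right),$$ and for $s\in[0,1]$ let $D_2^{-1}(s)=H_2^{-1}(1-s)$, where $H_2^{-1}$ is the inverse of the restriction of $H_2$ to $[0,\frac12]$. For $s,t\in[0,1]$ define $$\varphi(s,t)=\mathbb D_2\big(D_2^{-1}(s),D_2^{-1}(t)\big),\qquad \psi(s,t)=\mathbb D_2\big(D_2^{-1}(s),1-D_2^{-1}(t)\big),$$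 and, for real $q\neq0$ and $s,\alpha\in[0,1]$, $$\varphi_q(s)=\min_{0\le t\le1}\Big(\varphi(s,t)-\frac tq\Big),\qquad \psi_q(s)=\max_{0\le t\le1}\Big(\psi(s,t)-\frac tq\Big),$$ $$\widetilde\varphi_q(\alpha)=\min_{\alpha\le s\le1}\varphi_q(s)\quad(q\ge1),\qquad \widetilde\psi_q(\alpha)=\begin{cases}\max_{0\le s\le\alpha}\varphi_q(s), & q<0,\\ \max_{0\le s\le\alpha}\psi_q(s), & 0<q<1.\end{cases}$$ Then: 1. for every real $q\ge1$, $\widetilde\varphi_q=\varphi_q$ on $[0,1]$, and this function is convex on $[0,1]$; 2. for every $q\in(-\infty,0)\cup(0,1)$, $\widetilde\psi_q$ is concave on $[0,1]$. -/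

import Mathlib

open Set

noncomputable section

namespace DSBS

/-- Relative entropy `D(Q‖P)` (logarithms to base `2`) of two distributions on a finite set, given by
their mass functions. It is used only for `P` with full support, so that it is finite; a summand with
`Q x = 0` is `0`, which is the usual convention `0 log 0 = 0`. -/
def relEntropy {ι : Type*} [Fintype ι] (Q P : ι → ℝ) : ℝ :=
  ∑ x, Q x * Real.logb 2 (Q x / P x)

/-- The doubly symmetric binary distribution `P_XY` with correlation `ρ`
(rows are indexed by `x`, columns by `y`). -/
def dsbs (ρ : ℝ) : Matrix (Fin 2) (Fin 2) ℝ :=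
  !![(1 + ρ) / 4, (1 - ρ) / 4;
     (1 - ρ) / 4, (1 + ρ) / 4]

/-- The marginal `P_X` of the doubly symmetric binary distribution. -/
def dsbsX (ρ : ℝ) : Fin 2 → ℝ := fun x => ∑ y, dsbs ρ x y

/-- `D₂(a) = D((a, 1 - a) ‖ P_X)`. -/
def D2 (ρ a : ℝ) : ℝ := relEntropy ![a, 1 - a] (dsbsX ρ)

/-- The joint distribution on `{0,1}²` with `Q_X(1) = a`, `Q_Y(1) = b` and `Q_XY(1,1) = p`. -/
def coupling (a b p : ℝ) : Matrix (Fin 2) (Fin 2) ℝ :=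
  !![1 + p - a - b, b - p;
     a - p, p]

/-- `D₂^{(a,b)}(p)`: the relative entropy from the coupling with parameter `p` to `P_XY`. -/
def D2ab (ρ a b p : ℝ) : ℝ :=
  relEntropy (fun z : Fin 2 × Fin 2 => coupling a b p z.1 z.2)
    (fun z : Fin 2 × Fin 2 => dsbs ρ z.1 z.2)

/-- `𝔻₂(a,b)`: the minimum of `D₂^{(a,b)}(p)` over `max(0, a + b - 1) ≤ p ≤ min(a, b)`. -/
def DD2 (ρ a b : ℝ) : ℝ :=
  sInf ((fun p => D2ab ρ a b p) '' Icc (max 0 (a + b - 1)) (min a b))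

/-- The binary entropy function to base `2`. -/
def H2 (t : ℝ) : ℝ := -(t * Real.logb 2 t) - (1 - t) * Real.logb 2 (1 - t)

/-- The inverse of the restriction of the binary entropy function to `[0, 1/2]`. -/
def H2inv : ℝ → ℝ := Function.invFunOn H2 (Icc 0 (1 / 2))

/-- `D₂⁻¹(s) = H₂⁻¹(1 - s)`. -/
def D2inv (s : ℝ) : ℝ := H2inv (1 - s)

/-- The lower envelope `φ` of the minimum-relative-entropy region. -/
def phi (ρ s t : ℝ) : ℝ := DD2 ρ (D2inv s) (D2inv t)

/-- The upper envelope `ψ` of the minimum-relative-entropy region. -/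
def psi (ρ s t : ℝ) : ℝ := DD2 ρ (D2inv s) (1 - D2inv t)

/-- `φ_q(s) = min_{0 ≤ t ≤ 1} (φ(s,t) - t/q)`. -/
def phiQ (ρ q s : ℝ) : ℝ := sInf ((fun t => phi ρ s t - t / q) '' Icc 0 1)

/-- `ψ_q(s) = max_{0 ≤ t ≤ 1} (ψ(s,t) - t/q)`. -/
def psiQ (ρ q s : ℝ) : ℝ := sSup ((fun t => psi ρ s t - t / q) '' Icc 0 1)

/-- `φ̃_q(α) = min_{α ≤ s ≤ 1} φ_q(s)`, used for `q ≥ 1`. -/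
def phiTildeQ (ρ q α : ℝ) : ℝ := sInf (phiQ ρ q '' Icc α 1)

/-- `ψ̃_q(α)`, which is `max_{0 ≤ s ≤ α} φ_q(s)` for `q < 0` and `max_{0 ≤ s ≤ α} ψ_q(s)` for
`0 < q < 1`. -/
def psiTildeQ (ρ q α : ℝ) : ℝ :=
  if q < 0 then sSup (phiQ ρ q '' Icc 0 α) else sSup (psiQ ρ q '' Icc 0 α)

end DSBS

end

open Set

noncomputable section

namespace DSBS

/-! Put `a = D2inv s` for `q ≥ 1` and `a = 1 - D2inv s` for `q < 1`. In nats `klHalf a = s log 2`,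
so a bound affine in `klHalf a` is a supporting line in `s`. Lagrangian duality over couplings, with
tilt `(1, y)`, turns `φ_q(s) log 2` (`ψ_q` if `0 < q < 1`) into `klHalf a - noiseLog k q a y` at an
optimal `y`: a maximum of `noiseLog` for `q > 1`, a minimum for `q < 1`.

To support `noiseLog` at `a₀`, take a stationary `y₀` and choose `r` with `(mob k y₀) ^ r = a₀ / (1
- a₀)`. For `q > 1` this forces `r > 1`, and Gibbs' inequality gives `noiseLog k q a y ≤ hyperRatio
k q r y + klHalf a / r`, with equality at `(a₀, y₀)`. It remains that `y₀` maximises the two-point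
hypercontractivity ratio on `[0, 1]`. Its derivative has the sign of `mob k (mob k y ^ (r - 1)) - y
^ (q - 1)`, which changes sign only once because `log (mob k (exp x))` is concave on `[0, ∞)`. For
`q < 1` one gets `r < 0` and the inequalities reverse (`noiseLog_support_of_one_lt`,
`noiseLog_support_of_lt_one`).

The case `q = 1` is a limit. For `q ≥ 1`, convexity with `φ_q ≥ 0` and `φ_q(0) ≤ 0` gives
monotonicity, so the running minimum changes nothing; for `q < 1`, a running supremum preserves
concavity. -/

/-! ### The Möbius map `y ↦ (k + y) / (1 + k y)` -/

/-- The ratio of the two values of the noise operator at the function `(1, y)`. -/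
def mob (k y : ℝ) : ℝ := (k + y) / (1 + k * y)

lemma mob_pos {k y : ℝ} (hk : 0 < k) (hy : 0 ≤ y) : 0 < mob k y := by
  unfold mob; positivity

lemma mob_one {k : ℝ} (hk : 0 < k) : mob k 1 = 1 := by
  unfold mob; field_simp; ring

lemma mob_inv {k y : ℝ} (hk : 0 < k) (hy : 0 < y) : mob k y⁻¹ = (mob k y)⁻¹ := by
  unfold mob; field_simp; ring

lemma mob_mono {k x y : ℝ} (hk : 0 < k) (hk1 : k < 1) (hx : 0 ≤ x) (hxy : x ≤ y) :
    mob k x ≤ mob k y := by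
  have hy := hx.trans hxy
  unfold mob
  rw [div_le_div_iff₀ (by positivity) (by positivity)]
  nlinarith [mul_nonneg (sub_nonneg.2 hxy) (by nlinarith : 0 ≤ 1 - k ^ 2)]

lemma mob_lt {k x y : ℝ} (hk : 0 < k) (hk1 : k < 1) (hx : 0 ≤ x) (hxy : x < y) :
    mob k x < mob k y := by
  have hy := hx.trans hxy.le
  unfold mob
  rw [div_lt_div_iff₀ (by positivity) (by positivity)]
  nlinarith [mul_pos (sub_pos.2 hxy) (by nlinarith : 0 < 1 - k ^ 2)]

lemma mob_le_one {k y : ℝ} (hk : 0 < k) (hk1 : k < 1) (hy : 0 ≤ y) (hy1 : y ≤ 1) :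
    mob k y ≤ 1 := by
  simpa [mob_one hk] using mob_mono hk hk1 hy hy1

lemma mob_lt_one {k y : ℝ} (hk : 0 < k) (hk1 : k < 1) (hy : 0 ≤ y) (hy1 : y < 1) :
    mob k y < 1 := by
  simpa [mob_one hk] using mob_lt hk hk1 hy hy1

lemma hasDerivAt_log_mob_exp {k : ℝ} (hk : 0 < k) (x : ℝ) :
    HasDerivAt (fun x => Real.log (mob k (Real.exp x)))
      ((1 - k ^ 2) / (1 + k ^ 2 + 2 * k * Real.cosh x)) x := by
  have hx := Real.exp_pos x
  have h1 : HasDerivAt (fun x => k + Real.exp x) (Real.exp x) x :=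
    (Real.hasDerivAt_exp x).const_add k
  have h2 : HasDerivAt (fun x => 1 + k * Real.exp x) (k * Real.exp x) x :=
    ((Real.hasDerivAt_exp x).const_mul k).const_add 1
  have h3 := (h1.div h2 (by positivity)).log (div_pos (by positivity) (by positivity)).ne'
  refine h3.congr_deriv ?_
  simp only [Pi.div_apply]
  rw [Real.cosh_eq, Real.exp_neg]
  field_simp
  ring

/-- The derivative decreases as `cosh x` grows. The function vanishes at `0`, so concavity yields
sub-homogeneity under `x ↦ θ x`. -/
lemma concaveOn_log_mob_exp {k : ℝ} (hk : 0 < k) (hk1 : k < 1) :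
    ConcaveOn ℝ (Ici 0) (fun x => Real.log (mob k (Real.exp x))) := by
  refine AntitoneOn.concaveOn_of_deriv (convex_Ici 0)
    (fun x _ => (hasDerivAt_log_mob_exp hk x).continuousAt.continuousWithinAt)
    (fun x _ => (hasDerivAt_log_mob_exp hk x).differentiableAt.differentiableWithinAt) ?_
  intro x hx y hy hxy
  rw [interior_Ici] at hx hy
  rw [(hasDerivAt_log_mob_exp hk x).deriv, (hasDerivAt_log_mob_exp hk y).deriv]
  have hc : Real.cosh x ≤ Real.cosh y := by
    rw [Real.cosh_le_cosh, abs_of_pos hx, abs_of_pos hy]; exact hxy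
  have := Real.cosh_pos x
  have := Real.cosh_pos y
  gcongr
  nlinarith

/-- Sub-homogeneity of the Möbius map with respect to powers, on `[1, ∞)`. -/
lemma mob_rpow_le_of_one_le {k y θ : ℝ} (hk : 0 < k) (hk1 : k < 1) (hy : 1 ≤ y) (hθ : 0 ≤ θ)
    (hθ1 : θ ≤ 1) : mob k y ^ θ ≤ mob k (y ^ θ) := by
  have hy0 : 0 < y := by linarith
  have h := (concaveOn_log_mob_exp hk hk1).2 (mem_Ici.2 (Real.log_nonneg hy)) (mem_Ici.2 le_rfl)
    hθ (sub_nonneg.2 hθ1) (by ring)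
  simp only [smul_eq_mul, mul_zero, add_zero, Real.exp_zero, mob_one hk, Real.log_one,
    Real.exp_log hy0] at h
  rw [mul_comm θ (Real.log y), ← Real.rpow_def_of_pos hy0] at h
  have hm := mob_pos hk hy0.le
  rw [← Real.log_rpow hm] at h
  exact (Real.log_le_log_iff (by positivity) (mob_pos hk (by positivity))).1 h

/-- Inversion `y ↦ y⁻¹` commutes with `mob k`, which carries the bound on `[1, ∞)` to `(0, 1]` and
reverses it. -/
lemma mob_rpow_le {k y θ : ℝ} (hk : 0 < k) (hk1 : k < 1) (hy : 0 < y) (hy1 : y ≤ 1) (hθ : 0 ≤ θ)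
    (hθ1 : θ ≤ 1) : mob k (y ^ θ) ≤ mob k y ^ θ := by
  have h := mob_rpow_le_of_one_le hk hk1 ((one_le_inv₀ hy).2 hy1) hθ hθ1
  have hm := mob_pos hk hy.le
  rw [mob_inv hk hy, Real.inv_rpow hm.le, Real.inv_rpow hy.le, mob_inv hk (by positivity)] at h
  exact (inv_le_inv₀ (by positivity) (mob_pos hk (by positivity))).1 h

lemma rpow_mob_le {k y θ : ℝ} (hk : 0 < k) (hk1 : k < 1) (hy : 0 < y) (hy1 : y ≤ 1)
    (hθ1 : 1 ≤ θ) : mob k y ^ θ ≤ mob k (y ^ θ) := by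
  have hθ : 0 < θ := by linarith
  have h := mob_rpow_le hk hk1 (y := y ^ θ) (θ := θ⁻¹) (by positivity)
    (Real.rpow_le_one hy.le hy1 hθ.le) (by positivity) (inv_le_one_of_one_le₀ hθ1)
  rw [← Real.rpow_mul hy.le, mul_inv_cancel₀ hθ.ne', Real.rpow_one] at h
  have hm := mob_pos hk hy.le
  have hm' := mob_pos hk (y := y ^ θ) (by positivity)
  have h2 := Real.rpow_le_rpow hm.le h hθ.le
  rwa [← Real.rpow_mul hm'.le, inv_mul_cancel₀ hθ.ne', Real.rpow_one] at h2

/-- If the curve `y ↦ mob (mob y ^ m)` meets `y ↦ y ^ n` at `y₀`, it lies above to the left. -/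
lemma rpow_le_mob_mob_rpow {k m n y y₀ : ℝ} (hk : 0 < k) (hk1 : k < 1) (hm : 0 ≤ m)
    (hy : 0 < y) (hyy : y ≤ y₀) (hy1 : y₀ < 1) (h : mob k (mob k y₀ ^ m) = y₀ ^ n) :
    y ^ n ≤ mob k (mob k y ^ m) := by
  have hy0 : 0 < y₀ := hy.trans_le hyy
  have hl : Real.log y₀ < 0 := Real.log_neg hy0 hy1
  -- Both sides are compared with their values at `y₀` raised to `θ`; each of the two `mob` layers
  -- then costs one use of sub-homogeneity.
  obtain ⟨θ, hθ, rfl⟩ : ∃ θ : ℝ, 1 ≤ θ ∧ y = y₀ ^ θ := by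
    refine ⟨Real.log y / Real.log y₀, ?_, ?_⟩
    · rw [le_div_iff_of_neg hl, one_mul]; exact Real.log_le_log hy hyy
    · rw [Real.rpow_def_of_pos hy0, mul_div_cancel₀ _ hl.ne, Real.exp_log hy]
  have hM := mob_pos hk hy0.le
  have hMm : mob k y₀ ^ m ≤ 1 := Real.rpow_le_one hM.le (mob_le_one hk hk1 hy0.le hy1.le) hm
  calc (y₀ ^ θ) ^ n = (y₀ ^ n) ^ θ := by
        rw [← Real.rpow_mul hy0.le, ← Real.rpow_mul hy0.le, mul_comm]
    _ = mob k (mob k y₀ ^ m) ^ θ := by rw [h]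
    _ ≤ mob k ((mob k y₀ ^ m) ^ θ) := rpow_mob_le hk hk1 (by positivity) hMm hθ
    _ = mob k ((mob k y₀ ^ θ) ^ m) := by
        rw [← Real.rpow_mul hM.le, ← Real.rpow_mul hM.le, mul_comm]
    _ ≤ mob k (mob k (y₀ ^ θ) ^ m) :=
        mob_mono hk hk1 (by positivity)
          (Real.rpow_le_rpow (by positivity) (rpow_mob_le hk hk1 hy0 hy1.le hθ) hm)

/-- If the curve `y ↦ mob (mob y ^ m)` meets `y ↦ y ^ n` at `y₀`, it lies below to the right. -/
lemma mob_mob_rpow_le_rpow {k m n y y₀ : ℝ} (hk : 0 < k) (hk1 : k < 1) (hm : 0 ≤ m)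
    (hy0 : 0 < y₀) (hyy : y₀ ≤ y) (hy1 : y ≤ 1) (hy01 : y₀ < 1)
    (h : mob k (mob k y₀ ^ m) = y₀ ^ n) :
    mob k (mob k y ^ m) ≤ y ^ n := by
  have hy : 0 < y := hy0.trans_le hyy
  have hl : Real.log y₀ < 0 := Real.log_neg hy0 hy01
  obtain ⟨θ, hθ0, hθ, rfl⟩ : ∃ θ : ℝ, 0 ≤ θ ∧ θ ≤ 1 ∧ y = y₀ ^ θ := by
    refine ⟨Real.log y / Real.log y₀, ?_, ?_, ?_⟩
    · exact div_nonneg_of_nonpos (Real.log_nonpos hy.le hy1) hl.le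
    · rw [div_le_iff_of_neg hl, one_mul]; exact Real.log_le_log hy0 hyy
    · rw [Real.rpow_def_of_pos hy0, mul_div_cancel₀ _ hl.ne, Real.exp_log hy]
  have hM := mob_pos hk hy0.le
  have hMm : mob k y₀ ^ m ≤ 1 := Real.rpow_le_one hM.le (mob_le_one hk hk1 hy0.le hy01.le) hm
  have hM' := mob_pos hk (y := y₀ ^ θ) (by positivity)
  calc mob k (mob k (y₀ ^ θ) ^ m) ≤ mob k ((mob k y₀ ^ θ) ^ m) :=
        mob_mono hk hk1 (by positivity)
          (Real.rpow_le_rpow hM'.le (mob_rpow_le hk hk1 hy0 hy01.le hθ0 hθ) hm)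
    _ = mob k ((mob k y₀ ^ m) ^ θ) := by
        rw [← Real.rpow_mul hM.le, ← Real.rpow_mul hM.le, mul_comm]
    _ ≤ mob k (mob k y₀ ^ m) ^ θ := mob_rpow_le hk hk1 (by positivity) hMm hθ0 hθ
    _ = (y₀ ^ n) ^ θ := by rw [h]
    _ = (y₀ ^ θ) ^ n := by
        rw [← Real.rpow_mul hy0.le, ← Real.rpow_mul hy0.le, mul_comm]

/-! ### The logarithm of the hypercontractivity ratio -/

/-- `log (‖T f‖_r / ‖f‖_q)` for `f = (1, y)` and the noise operator `T` of the doubly symmetric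
binary distribution, where `k = (1 - ρ) / (1 + ρ)`. -/
def hyperRatio (k q r y : ℝ) : ℝ :=
  Real.log (1 + k * y) - Real.log (1 + k) + 1 / r * Real.log ((1 + mob k y ^ r) / 2)
    - 1 / q * Real.log ((1 + y ^ q) / 2)

lemma hasDerivAt_mob {k y : ℝ} (hk : 0 < k) (hy : 0 ≤ y) :
    HasDerivAt (mob k) ((1 - k ^ 2) / (1 + k * y) ^ 2) y := by
  have h1 : HasDerivAt (fun x => k + x) 1 y := (hasDerivAt_id y).const_add k
  have h2 : HasDerivAt (fun x => 1 + k * x) (k * 1) y :=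
    ((hasDerivAt_id y).const_mul k).const_add 1
  refine (h1.div h2 (by positivity)).congr_deriv ?_
  congr 1; ring

/-- The factored form isolates the only factor whose sign can vary. -/
lemma hasDerivAt_hyperRatio {k q r y : ℝ} (hk : 0 < k) (hq : q ≠ 0) (hr : r ≠ 0) (hy : 0 < y) :
    HasDerivAt (hyperRatio k q r)
      ((1 + k * mob k y ^ (r - 1)) * (mob k (mob k y ^ (r - 1)) - y ^ (q - 1)) /
        ((1 + k * y + mob k y ^ (r - 1) * (k + y)) * (1 + y ^ q))) y := by
  have hM := mob_pos hk hy.le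
  have h1 : HasDerivAt (fun x => Real.log (1 + k * x)) (k * 1 / (1 + k * y)) y :=
    (((hasDerivAt_id y).const_mul k).const_add 1).log (by simp only [id]; positivity)
  have h2 := (((((hasDerivAt_mob hk hy.le).rpow_const (p := r) (Or.inl hM.ne')).const_add 1).div_const
    2).log (by positivity)).const_mul (1 / r)
  have h3 := ((((Real.hasDerivAt_rpow_const (p := q) (Or.inl hy.ne')).const_add 1).div_const
    2).log (by positivity)).const_mul (1 / q)
  refine (((h1.sub_const (Real.log (1 + k))).add h2).sub h3).congr_deriv ?_
  have e1 : mob k y ^ r = mob k y ^ (r - 1) * mob k y := by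
    rw [← Real.rpow_add_one hM.ne']; ring_nf
  have e2 : y ^ q = y ^ (q - 1) * y := by
    rw [← Real.rpow_add_one hy.ne']; ring_nf
  have hx : 0 < mob k y ^ (r - 1) := by positivity
  have hu : 0 < y ^ (q - 1) := by positivity
  rw [e1, e2]
  generalize mob k y ^ (r - 1) = x at *
  generalize y ^ (q - 1) = u at *
  unfold mob
  have p1 : 0 < 1 + k * y := by positivity
  have p2 : 0 < k + y := by positivity
  have p3 : 1 + k * y + x * (k + y) ≠ 0 := by positivity
  have p4 : 1 + k * x ≠ 0 := by positivity
  have p5 : 1 + u * y ≠ 0 := by positivity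
  have p6 : 1 + x * ((k + y) / (1 + k * y)) = (1 + k * y + x * (k + y)) / (1 + k * y) := by
    field_simp
  rw [p6]
  field_simp
  ring

lemma continuousOn_hyperRatio {k q r : ℝ} (hk : 0 < k) (hq : 0 < q) :
    ContinuousOn (hyperRatio k q r) (Ici 0) := by
  intro y hy
  have hy : 0 ≤ y := hy
  have hM := mob_pos hk hy
  refine ContinuousAt.continuousWithinAt ?_
  have c1 : ContinuousAt (mob k) y := (hasDerivAt_mob hk hy).continuousAt
  have c2 : ContinuousAt (fun y => mob k y ^ r) y := c1.rpow_const (Or.inl hM.ne')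
  have c3 : ContinuousAt (fun y : ℝ => y ^ q) y := continuousAt_id.rpow_const (Or.inr hq.le)
  have c4 : ContinuousAt (fun y => Real.log (1 + k * y)) y :=
    ContinuousAt.log (by fun_prop) (by positivity)
  have c5 : ContinuousAt (fun y => Real.log ((1 + mob k y ^ r) / 2)) y :=
    ContinuousAt.log (by fun_prop) (by positivity)
  have c6 : ContinuousAt (fun y : ℝ => Real.log ((1 + y ^ q) / 2)) y :=
    ContinuousAt.log (by fun_prop) (by positivity)
  unfold hyperRatio
  fun_prop

lemma continuousOn_hyperRatio_of_pos {k q r : ℝ} (hk : 0 < k) (hq : q ≠ 0) (hr : r ≠ 0)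
    {s : Set ℝ} (hs : ∀ y ∈ s, 0 < y) : ContinuousOn (hyperRatio k q r) s := fun y hy =>
  (hasDerivAt_hyperRatio hk hq hr (hs y hy)).continuousAt.continuousWithinAt

lemma tendsto_hyperRatio_zero {k q r : ℝ} (hk : 0 < k) (hq : 0 < q) :
    Filter.Tendsto (hyperRatio k q r) (nhdsWithin 0 (Ioi 0)) (nhds (hyperRatio k q r 0)) :=
  ((continuousOn_hyperRatio hk hq) 0 (mem_Ici.2 le_rfl)).mono Ioi_subset_Ici_self

lemma hyperRatio_le_of_one_lt {k q r y y₀ : ℝ} (hk : 0 < k) (hk1 : k < 1) (hq : 1 < q) (hr : 1 < r)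
    (hy₀ : 0 < y₀) (hy₀1 : y₀ < 1) (h : mob k (mob k y₀ ^ (r - 1)) = y₀ ^ (q - 1))
    (hy : 0 ≤ y) (hy1 : y ≤ 1) : hyperRatio k q r y ≤ hyperRatio k q r y₀ := by
  have hq0 : q ≠ 0 := by linarith
  have hr0 : r ≠ 0 := by linarith
  have hmono : MonotoneOn (hyperRatio k q r) (Ioc 0 y₀) := by
    refine monotoneOn_of_deriv_nonneg (convex_Ioc _ _)
      (continuousOn_hyperRatio_of_pos hk hq0 hr0 fun y hy => hy.1) ?_ ?_ <;>
    rw [interior_Ioc] <;> intro x hx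
    · exact (hasDerivAt_hyperRatio hk hq0 hr0 hx.1).differentiableAt.differentiableWithinAt
    · rw [(hasDerivAt_hyperRatio hk hq0 hr0 hx.1).deriv]
      have hx0 := hx.1
      have hM := mob_pos hk hx0.le
      have := rpow_le_mob_mob_rpow hk hk1 (by linarith) hx0 hx.2.le hy₀1 h
      have := sub_nonneg.2 this
      positivity
  have hanti : AntitoneOn (hyperRatio k q r) (Icc y₀ 1) := by
    refine antitoneOn_of_deriv_nonpos (convex_Icc _ _)
      (continuousOn_hyperRatio_of_pos hk hq0 hr0 fun y hy => hy₀.trans_le hy.1) ?_ ?_ <;>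
    rw [interior_Icc] <;> intro x hx <;> have hx0 := hy₀.trans hx.1
    · exact (hasDerivAt_hyperRatio hk hq0 hr0 hx0).differentiableAt.differentiableWithinAt
    · rw [(hasDerivAt_hyperRatio hk hq0 hr0 hx0).deriv]
      have hM := mob_pos hk hx0.le
      have := mob_mob_rpow_le_rpow hk hk1 (by linarith) hy₀ hx.1.le hx.2.le hy₀1 h
      have := sub_nonpos.2 this
      exact div_nonpos_of_nonpos_of_nonneg (mul_nonpos_of_nonneg_of_nonpos (by positivity) this)
        (by positivity)
  rcases hy.eq_or_lt with rfl | hy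
  · refine le_of_tendsto (tendsto_hyperRatio_zero hk (by linarith)) ?_
    filter_upwards [Ioc_mem_nhdsGT hy₀] with x hx
    exact hmono hx ⟨hy₀, le_rfl⟩ hx.2
  · rcases le_total y y₀ with h1 | h1
    · exact hmono ⟨hy, h1⟩ ⟨hy₀, le_rfl⟩ h1
    · exact hanti ⟨le_rfl, hy₀1.le⟩ ⟨h1, hy1⟩ h1

/-- For `r < 0` this replaces the negative exponent `r - 1` by `1 - r`, where the crossing lemmas
apply. -/
lemma mob_mob_rpow_neg {k m n y : ℝ} (hk : 0 < k) (hy : 0 < y) :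
    mob k (mob k y ^ (-m)) - y ^ (-n) = (mob k (mob k y ^ m))⁻¹ - (y ^ n)⁻¹ := by
  have hM := mob_pos hk hy.le
  rw [Real.rpow_neg hM.le, Real.rpow_neg hy.le, mob_inv hk (by positivity)]

/-- The condition `hyq` excludes `y = 0` for negative `q`, where the convention `0 ^ q = 0` breaks
continuity. -/
lemma hyperRatio_ge_of_lt_one {k q r y y₀ : ℝ} (hk : 0 < k) (hk1 : k < 1) (hq : q ≠ 0) (hr : r < 0)
    (hy₀ : 0 < y₀) (hy₀1 : y₀ < 1) (h : mob k (mob k y₀ ^ (r - 1)) = y₀ ^ (q - 1))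
    (hy : 0 ≤ y) (hy1 : y ≤ 1) (hyq : y = 0 → 0 < q) :
    hyperRatio k q r y₀ ≤ hyperRatio k q r y := by
  have hr0 : r ≠ 0 := hr.ne
  have h' : mob k (mob k y₀ ^ (1 - r)) = y₀ ^ (1 - q) := by
    have := mob_mob_rpow_neg (m := 1 - r) (n := 1 - q) hk hy₀
    rw [neg_sub, neg_sub, h, sub_self, eq_comm, sub_eq_zero] at this
    exact inv_injective this
  have key : ∀ x, 0 < x → mob k (mob k x ^ (r - 1)) - x ^ (q - 1) =
      (mob k (mob k x ^ (1 - r)))⁻¹ - (x ^ (1 - q))⁻¹ := fun x hx => by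
    simpa using mob_mob_rpow_neg (m := 1 - r) (n := 1 - q) hk hx
  have hanti : AntitoneOn (hyperRatio k q r) (Ioc 0 y₀) := by
    refine antitoneOn_of_deriv_nonpos (convex_Ioc _ _)
      (continuousOn_hyperRatio_of_pos hk hq hr0 fun y hy => hy.1) ?_ ?_ <;>
    rw [interior_Ioc] <;> intro x hx <;> have hx0 := hx.1
    · exact (hasDerivAt_hyperRatio hk hq hr0 hx.1).differentiableAt.differentiableWithinAt
    · rw [(hasDerivAt_hyperRatio hk hq hr0 hx.1).deriv, key x hx0]
      have hM := mob_pos hk hx0.le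
      have := rpow_le_mob_mob_rpow hk hk1 (by linarith) hx0 hx.2.le hy₀1 h'
      have := sub_nonpos.2 (inv_anti₀ (by positivity) this)
      exact div_nonpos_of_nonpos_of_nonneg (mul_nonpos_of_nonneg_of_nonpos (by positivity) this)
        (by positivity)
  have hmono : MonotoneOn (hyperRatio k q r) (Icc y₀ 1) := by
    refine monotoneOn_of_deriv_nonneg (convex_Icc _ _)
      (continuousOn_hyperRatio_of_pos hk hq hr0 fun y hy => hy₀.trans_le hy.1) ?_ ?_ <;>
    rw [interior_Icc] <;> intro x hx <;> have hx0 := hy₀.trans hx.1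
    · exact (hasDerivAt_hyperRatio hk hq hr0 hx0).differentiableAt.differentiableWithinAt
    · rw [(hasDerivAt_hyperRatio hk hq hr0 hx0).deriv, key x hx0]
      have hM := mob_pos hk hx0.le
      have := mob_mob_rpow_le_rpow hk hk1 (by linarith) hy₀ hx.1.le hx.2.le hy₀1 h'
      have := sub_nonneg.2 (inv_anti₀ (mob_pos hk (by positivity)) this)
      positivity
  rcases hy.eq_or_lt with rfl | hy
  · refine ge_of_tendsto (tendsto_hyperRatio_zero hk (hyq rfl)) ?_
    filter_upwards [Ioc_mem_nhdsGT hy₀] with x hx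
    exact hanti hx ⟨hy₀, le_rfl⟩ hx.2
  · rcases le_total y y₀ with h1 | h1
    · exact hanti ⟨hy, h1⟩ ⟨hy₀, le_rfl⟩ h1
    · exact hmono ⟨le_rfl, hy₀1.le⟩ ⟨h1, hy1⟩ h1

/-! ### Gibbs' inequality -/

lemma sub_le_mul_log_div {u w : ℝ} (hu : 0 ≤ u) (hw : 0 ≤ w) (h : w = 0 → u = 0) :
    u - w ≤ u * Real.log (u / w) := by
  rcases hu.eq_or_lt with rfl | hu
  · simpa using hw
  have hw : 0 < w := hw.lt_of_ne fun h0 => hu.ne' (h h0.symm)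
  have := mul_le_mul_of_nonneg_left (Real.one_sub_inv_le_log_of_pos (div_pos hu hw)) hu.le
  refine le_trans (le_of_eq ?_) this
  field_simp

/-- The two-term log-sum inequality, tilted by the weight `y` on the second term. -/
lemma log_sum_le {u v α β y : ℝ} (hu : 0 ≤ u) (hv : 0 ≤ v) (hα : 0 < α) (hβ : 0 < β) (hy : 0 ≤ y)
    (h : y = 0 → v = 0) :
    (u + v) * Real.log ((u + v) / (α + β * y)) + v * Real.log y ≤
      u * Real.log (u / α) + v * Real.log (v / β) := by
  have hS : 0 < α + β * y := by positivity
  rcases (add_nonneg hu hv).eq_or_lt with h0 | hU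
  · obtain rfl : u = 0 := by linarith
    obtain rfl : v = 0 := by linarith
    simp
  -- The reference masses `α` and `β * y` are rescaled to total `u + v`, so the linear terms cancel
  -- when the two bounds are added.
  have h1 := sub_le_mul_log_div (w := α * ((u + v) / (α + β * y))) hu (by positivity)
    fun h0 => absurd h0 (by positivity)
  have h2 := sub_le_mul_log_div (w := β * y * ((u + v) / (α + β * y))) hv (by positivity)
    fun h0 => h (by
      have : (u + v) / (α + β * y) ≠ 0 := by positivity
      simpa [hβ.ne', this] using h0)
  have e1 : u * Real.log (u / (α * ((u + v) / (α + β * y)))) =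
      u * Real.log (u / α) - u * Real.log ((u + v) / (α + β * y)) := by
    rcases hu.eq_or_lt with rfl | hu
    · simp
    rw [← div_div, Real.log_div (by positivity) (by positivity)]; ring
  have e2 : v * Real.log (v / (β * y * ((u + v) / (α + β * y)))) =
      v * Real.log (v / β) - v * Real.log y - v * Real.log ((u + v) / (α + β * y)) := by
    rcases hv.eq_or_lt with rfl | hv
    · simp
    have hy : 0 < y := hy.lt_of_ne fun h0 => hv.ne' (h h0.symm)
    rw [← div_div, ← div_div, Real.log_div (by positivity) (by positivity),
      Real.log_div (by positivity) (by positivity)]; ring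
  have e3 : α * ((u + v) / (α + β * y)) + β * y * ((u + v) / (α + β * y)) = u + v := by
    field_simp
  rw [e1] at h1
  rw [e2] at h2
  linarith

/-- The relative entropy, in nats, from `(1 - a, a)` to the uniform distribution. -/
def klHalf (a : ℝ) : ℝ := a * Real.log (2 * a) + (1 - a) * Real.log (2 * (1 - a))

lemma klHalf_symm (a : ℝ) : klHalf (1 - a) = klHalf a := by
  unfold klHalf; rw [sub_sub_cancel]; ring

/-- Gibbs' inequality against the distribution `(1, w) / (1 + w)`; `klHalf_eq` is the equality case.
-/
lemma klHalf_ge {b w : ℝ} (hb : 0 ≤ b) (hb1 : b ≤ 1) (hw : 0 ≤ w) (h : w = 0 → b = 0) :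
    b * Real.log w - Real.log ((1 + w) / 2) ≤ klHalf b := by
  have := log_sum_le (α := 1 / 2) (β := 1 / 2) (sub_nonneg.2 hb1) hb (by norm_num) (by norm_num) hw h
  have e : (1 - b + b) / (1 / 2 + 1 / 2 * w) = ((1 + w) / 2)⁻¹ := by
    rw [sub_add_cancel, inv_eq_one_div]; ring
  rw [e, Real.log_inv, sub_add_cancel] at this
  simp only [div_div_eq_mul_div, div_one] at this
  unfold klHalf
  rw [mul_comm 2 b, mul_comm 2 (1 - b)]
  linarith

lemma klHalf_eq {w : ℝ} (hw : 0 ≤ w) :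
    klHalf (w / (1 + w)) = w / (1 + w) * Real.log w - Real.log ((1 + w) / 2) := by
  rcases hw.eq_or_lt with rfl | hw
  · simp [klHalf]
  have e : 1 - w / (1 + w) = 1 / (1 + w) := by field_simp; ring
  have e1 : 2 * (w / (1 + w)) = w * ((1 + w) / 2)⁻¹ := by field_simp
  have e2 : 2 * (1 / (1 + w)) = ((1 + w) / 2)⁻¹ := by field_simp
  unfold klHalf
  rw [e, e1, e2, Real.log_mul (by positivity) (by positivity), Real.log_inv]
  field_simp
  ring

/-! ### Stationary points and supporting lines -/

/-- `E[log T f] - log ‖f‖_q` for `f = (1, y)`, where the expectation is with respect to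
`(1 - a, a)`, `T` is the noise operator and `k = (1 - ρ) / (1 + ρ)`. -/
def noiseLog (k q a y : ℝ) : ℝ :=
  Real.log (1 + k * y) - Real.log (1 + k) + a * Real.log (mob k y)
    - 1 / q * Real.log ((1 + y ^ q) / 2)

/-- The second marginal of the tilted coupling with first marginal `(1 - a, a)` and tilt
`(1, y)`. -/
def tiltMarg (k a y : ℝ) : ℝ := (1 - a) * (k * y / (1 + k * y)) + a * (y / (k + y))

lemma continuousOn_tiltMarg {k : ℝ} (hk : 0 < k) (a : ℝ) : ContinuousOn (tiltMarg k a) (Ici 0) := by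
  unfold tiltMarg
  refine ContinuousOn.add (ContinuousOn.mul continuousOn_const (ContinuousOn.div (by fun_prop)
    (by fun_prop) ?_)) (ContinuousOn.mul continuousOn_const (ContinuousOn.div (by fun_prop)
    (by fun_prop) ?_)) <;> intro y hy <;> have hy : 0 ≤ y := hy <;> positivity

lemma tiltMarg_one {k : ℝ} (hk : 0 < k) (a : ℝ) : tiltMarg k a 1 = (k + a * (1 - k)) / (1 + k) := by
  unfold tiltMarg; field_simp; ring

lemma noiseLog_eq {k q r : ℝ} (a : ℝ) {y : ℝ} (hk : 0 < k) (hr : r ≠ 0) (hy : 0 ≤ y) :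
    noiseLog k q a y = hyperRatio k q r y +
      1 / r * (a * Real.log (mob k y ^ r) - Real.log ((1 + mob k y ^ r) / 2)) := by
  rw [Real.log_rpow (mob_pos hk hy)]
  unfold noiseLog hyperRatio
  field_simp
  ring

/-! ### Existence of stationary tilts, and the supporting lines they give. -/

/-- The equation says that `y` times the `y`-derivative of `noiseLog k q a` vanishes. -/
lemma exists_tiltMarg_eq_of_one_lt {k q a : ℝ} (hk : 0 < k) (hk1 : k < 1) (hq : 1 < q)
    (ha : 0 < a) (ha1 : a < 1 / 2) :
    ∃ y, 0 < y ∧ y < 1 ∧ tiltMarg k a y = y ^ q / (1 + y ^ q) := by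
  -- Chosen so that `z ^ q = k * z`: the right side at `z` is then the smaller of the two
  -- conditional probabilities averaged in `tiltMarg`.
  set z : ℝ := k ^ (1 / (q - 1)) with hz
  have hq1 : 0 < q - 1 := by linarith
  have hz0 : 0 < z := by positivity
  have hz1 : z ≤ 1 := Real.rpow_le_one hk.le hk1.le (by positivity)
  have hzq : z ^ q = k * z := by
    have : z ^ (q - 1) = k := by
      rw [hz, ← Real.rpow_mul hk.le, one_div_mul_cancel hq1.ne', Real.rpow_one]
    rw [← this, ← Real.rpow_add_one hz0.ne']; ring_nf
  have hc : ContinuousOn (fun y => tiltMarg k a y - y ^ q / (1 + y ^ q)) (Icc z 1) := by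
    intro y hy
    have hy0 : 0 < y := hz0.trans_le hy.1
    have c : ContinuousAt (fun y : ℝ => y ^ q) y := continuousAt_id.rpow_const (Or.inl hy0.ne')
    exact ((continuousOn_tiltMarg hk a).mono (fun x hx => hz0.le.trans hx.1) y hy).sub
      (c.div (by fun_prop) (by positivity)).continuousWithinAt
  have h1 : tiltMarg k a 1 - 1 ^ q / (1 + 1 ^ q) < 0 := by
    rw [tiltMarg_one hk, Real.one_rpow, sub_neg, div_lt_div_iff₀ (by positivity) (by positivity)]
    nlinarith
  have hz2 : 0 ≤ tiltMarg k a z - z ^ q / (1 + z ^ q) := by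
    rw [hzq]
    have : k * z / (1 + k * z) ≤ z / (k + z) := by
      rw [div_le_div_iff₀ (by positivity) (by positivity)]
      nlinarith [mul_nonneg hz0.le (by nlinarith : 0 ≤ 1 - k ^ 2)]
    unfold tiltMarg
    nlinarith
  obtain ⟨y, hy, hy0⟩ := intermediate_value_Icc' hz1 hc ⟨h1.le, hz2⟩
  refine ⟨y, hz0.trans_le hy.1, hy.2.lt_of_ne ?_, sub_eq_zero.1 hy0⟩
  rintro rfl
  exact h1.ne hy0

lemma exists_tiltMarg_eq_of_lt_one {k q a : ℝ} (hk : 0 < k) (hk1 : k < 1) (hq : q < 1)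
    (ha : 1 / 2 ≤ a) (ha1 : a ≤ 1) :
    ∃ y, 0 < y ∧ y ≤ 1 ∧ tiltMarg k a y = y ^ q / (1 + y ^ q) := by
  -- Now `z ^ q = z / k`, and the right side at `z` is the larger conditional probability.
  set z : ℝ := k ^ (1 / (1 - q)) with hz
  have hq1 : 0 < 1 - q := by linarith
  have hz0 : 0 < z := by positivity
  have hz1 : z ≤ 1 := Real.rpow_le_one hk.le hk1.le (by positivity)
  have hzq : z ^ q = z / k := by
    have : z ^ (1 - q) = k := by
      rw [hz, ← Real.rpow_mul hk.le, one_div_mul_cancel hq1.ne', Real.rpow_one]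
    rw [eq_div_iff hk.ne', ← this, ← Real.rpow_add hz0]; simp
  have hc : ContinuousOn (fun y => tiltMarg k a y - y ^ q / (1 + y ^ q)) (Icc z 1) := by
    intro y hy
    have hy0 : 0 < y := hz0.trans_le hy.1
    have c : ContinuousAt (fun y : ℝ => y ^ q) y := continuousAt_id.rpow_const (Or.inl hy0.ne')
    exact ((continuousOn_tiltMarg hk a).mono (fun x hx => hz0.le.trans hx.1) y hy).sub
      (c.div (by fun_prop) (by positivity)).continuousWithinAt
  have h1 : 0 ≤ tiltMarg k a 1 - 1 ^ q / (1 + 1 ^ q) := by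
    rw [tiltMarg_one hk, Real.one_rpow, sub_nonneg, div_le_div_iff₀ (by positivity) (by positivity)]
    nlinarith
  have hz2 : tiltMarg k a z - z ^ q / (1 + z ^ q) ≤ 0 := by
    have e : z ^ q / (1 + z ^ q) = z / (k + z) := by rw [hzq]; field_simp
    rw [e]
    have : k * z / (1 + k * z) ≤ z / (k + z) := by
      rw [div_le_div_iff₀ (by positivity) (by positivity)]
      nlinarith [mul_nonneg hz0.le (by nlinarith : 0 ≤ 1 - k ^ 2)]
    unfold tiltMarg
    nlinarith
  obtain ⟨y, hy, hy0⟩ := intermediate_value_Icc hz1 hc ⟨hz2, h1⟩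
  exact ⟨y, hz0.trans_le hy.1, hy.2, sub_eq_zero.1 hy0⟩

/-- At a stationary point there is an exponent `r` for which `y` is critical for the
`(q, r)`-hypercontractivity ratio. -/
lemma exists_critical_exponent {k q a y : ℝ} (hk : 0 < k) (hk1 : k < 1) (ha : 0 < a) (ha1 : a < 1)
    (hy : 0 < y) (hy1 : y < 1) (h : tiltMarg k a y = y ^ q / (1 + y ^ q)) :
    mob k y ^ (Real.log (a / (1 - a)) / Real.log (mob k y)) = a / (1 - a) ∧
    mob k (mob k y ^ (Real.log (a / (1 - a)) / Real.log (mob k y) - 1)) = y ^ (q - 1) := by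
  have hM := mob_pos hk hy.le
  have hM1 := mob_lt_one hk hk1 hy.le hy1
  have hl := Real.log_neg hM hM1
  have ha2 : 0 < 1 - a := by linarith
  have hr : mob k y ^ (Real.log (a / (1 - a)) / Real.log (mob k y)) = a / (1 - a) := by
    rw [Real.rpow_def_of_pos hM, mul_div_cancel₀ _ hl.ne, Real.exp_log (by positivity)]
  refine ⟨hr, ?_⟩
  rw [Real.rpow_sub_one hM.ne', hr]
  have e2 : y ^ q = y ^ (q - 1) * y := by
    rw [← Real.rpow_add_one hy.ne']; ring_nf
  rw [e2] at h
  have hu : 0 < y ^ (q - 1) := by positivity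
  generalize y ^ (q - 1) = u at *
  unfold tiltMarg at h
  unfold mob
  have p1 : 0 < 1 + k * y := by positivity
  have p2 : 0 < k + y := by positivity
  have p3 : 0 < 1 + u * y := by positivity
  rw [div_eq_iff (by positivity)]
  field_simp at h ⊢
  linear_combination h

lemma noiseLog_support_of_one_lt {k q a₀ : ℝ} (hk : 0 < k) (hk1 : k < 1) (hq : 1 < q)
    (ha : 0 < a₀) (ha1 : a₀ < 1 / 2) :
    ∃ y₀ c, 0 < y₀ ∧ y₀ < 1 ∧ tiltMarg k a₀ y₀ = y₀ ^ q / (1 + y₀ ^ q) ∧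
      ∀ a y, 0 ≤ a → a ≤ 1 → 0 ≤ y → y ≤ 1 →
        noiseLog k q a y - c * klHalf a ≤ noiseLog k q a₀ y₀ - c * klHalf a₀ := by
  obtain ⟨y₀, hy, hy1, hst⟩ := exists_tiltMarg_eq_of_one_lt hk hk1 hq ha ha1
  have hM := mob_pos hk hy.le
  have hM1 := mob_lt_one hk hk1 hy.le hy1
  obtain ⟨hr, hcrit⟩ := exists_critical_exponent hk hk1 ha (by linarith) hy hy1 hst
  set r := Real.log (a₀ / (1 - a₀)) / Real.log (mob k y₀)
  have hr1 : 1 < r := by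
    -- If `r ≤ 1`, the left side of the critical equation is at least `1`, while `y₀ ^ (q - 1) < 1`.
    by_contra! hcon
    have h1 := Real.one_le_rpow_of_pos_of_le_one_of_nonpos hM hM1.le (sub_nonpos.2 hcon)
    have h2 := mob_mono hk hk1 zero_le_one h1
    rw [mob_one hk, hcrit] at h2
    exact absurd h2 (not_le.2 (Real.rpow_lt_one hy.le hy1 (by linarith)))
  have hr0 : 0 < r := by linarith
  refine ⟨y₀, 1 / r, hy, hy1, hst, fun a y h0 h1 hy0 hy1' => ?_⟩
  have hw := mob_pos hk hy0
  have e0 : a₀ = mob k y₀ ^ r / (1 + mob k y₀ ^ r) := by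
    have : 1 - a₀ ≠ 0 := by linarith
    rw [hr]; field_simp; ring
  have g0 := klHalf_eq (w := mob k y₀ ^ r) (by positivity)
  rw [← e0] at g0
  have g := klHalf_ge h0 h1 (w := mob k y ^ r) (by positivity) fun h => absurd h (by positivity)
  rw [noiseLog_eq (r := r) a hk hr0.ne' hy0, noiseLog_eq (r := r) a₀ hk hr0.ne' hy.le, g0]
  have := mul_le_mul_of_nonneg_left g (by positivity : 0 ≤ 1 / r)
  have := hyperRatio_le_of_one_lt hk hk1 hq hr1 hy hy1 hcrit hy0 hy1'
  linarith

lemma noiseLog_support_of_lt_one {k q a₀ : ℝ} (hk : 0 < k) (hk1 : k < 1) (hq : q < 1) (hq0 : q ≠ 0)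
    (ha : 1 / 2 < a₀) (ha1 : a₀ < 1) :
    ∃ y₀ c, 0 < y₀ ∧ y₀ < 1 ∧ tiltMarg k a₀ y₀ = y₀ ^ q / (1 + y₀ ^ q) ∧
      ∀ a y, 0 ≤ a → a ≤ 1 → 0 ≤ y → y ≤ 1 → (y = 0 → 0 < q) →
        noiseLog k q a₀ y₀ - c * klHalf a₀ ≤ noiseLog k q a y - c * klHalf a := by
  obtain ⟨y₀, hy, hy1, hst⟩ := exists_tiltMarg_eq_of_lt_one hk hk1 hq ha.le ha1.le
  -- A stationary point at `1` would force `a₀ = 1 / 2`.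
  have hy1 : y₀ < 1 := hy1.lt_of_ne fun h => by
    rw [h, tiltMarg_one hk, Real.one_rpow, div_eq_div_iff (by positivity) (by positivity)] at hst
    nlinarith
  have hM := mob_pos hk hy.le
  have hM1 := mob_lt_one hk hk1 hy.le hy1
  obtain ⟨hr, hcrit⟩ := exists_critical_exponent hk hk1 (by linarith) ha1 hy hy1 hst
  set r := Real.log (a₀ / (1 - a₀)) / Real.log (mob k y₀) with hrdef
  have hr0 : r < 0 := div_neg_of_pos_of_neg
    (Real.log_pos (by rw [lt_div_iff₀ (by linarith)]; linarith)) (Real.log_neg hM hM1)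
  refine ⟨y₀, 1 / r, hy, hy1, hst, fun a y h0 h1 hy0 hy1' hyq => ?_⟩
  have hw := mob_pos hk hy0
  have e0 : a₀ = mob k y₀ ^ r / (1 + mob k y₀ ^ r) := by
    have : 1 - a₀ ≠ 0 := by linarith
    rw [hr]; field_simp; ring
  have g0 := klHalf_eq (w := mob k y₀ ^ r) (by positivity)
  rw [← e0] at g0
  have g := klHalf_ge h0 h1 (w := mob k y ^ r) (by positivity) fun h => absurd h (by positivity)
  rw [noiseLog_eq (r := r) a hk hr0.ne hy0, noiseLog_eq (r := r) a₀ hk hr0.ne hy.le, g0]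
  have := mul_le_mul_of_nonpos_left g (one_div_nonpos.2 hr0.le)
  have := hyperRatio_ge_of_lt_one hk hk1 hq0 hr0 hy hy1 hcrit hy0 hy1' hyq
  linarith

/-! ### Bounds on the minimum relative entropy of a coupling -/

lemma D2ab_mul_log (ρ a b p : ℝ) : D2ab ρ a b p * Real.log 2 =
    ((1 + p - a - b) * Real.log ((1 + p - a - b) / ((1 + ρ) / 4)) +
      (b - p) * Real.log ((b - p) / ((1 - ρ) / 4))) +
    ((a - p) * Real.log ((a - p) / ((1 - ρ) / 4)) + p * Real.log (p / ((1 + ρ) / 4))) := by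
  have : Real.log 2 ≠ 0 := (Real.log_pos one_lt_two).ne'
  simp only [D2ab, relEntropy, coupling, dsbs, Fintype.sum_prod_type, Fin.sum_univ_two,
    Matrix.of_apply, Matrix.cons_val', Matrix.cons_val_zero, Matrix.cons_val_one,
    Matrix.cons_val_fin_one, Real.logb]
  field_simp

/-- The parameter `k = (1 - ρ) / (1 + ρ)` of the Möbius map. -/
def mobParam (ρ : ℝ) : ℝ := (1 - ρ) / (1 + ρ)

lemma mobParam_pos {ρ : ℝ} (hρ : ρ ∈ Ioo (0 : ℝ) 1) : 0 < mobParam ρ :=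
  div_pos (sub_pos.2 hρ.2) (by linarith [hρ.1])

lemma mobParam_lt_one {ρ : ℝ} (hρ : ρ ∈ Ioo (0 : ℝ) 1) : mobParam ρ < 1 := by
  unfold mobParam
  rw [div_lt_one (by linarith [hρ.1])]; linarith [hρ.1]

lemma row_sum_eq {ρ y c : ℝ} (hρ : ρ ∈ Ioo (0 : ℝ) 1) (hy : 0 ≤ y) (hc : 0 ≤ c) :
    c * Real.log (c / ((1 + ρ) / 4 + (1 - ρ) / 4 * y)) =
      c * (Real.log (2 * c) - Real.log (1 + mobParam ρ * y) + Real.log (1 + mobParam ρ)) := by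
  have hk := mobParam_pos hρ
  rcases hc.eq_or_lt with rfl | hc
  · simp
  have h1 : 0 < 1 + ρ := by linarith [hρ.1]
  have e : c / ((1 + ρ) / 4 + (1 - ρ) / 4 * y) =
      2 * c / (1 + mobParam ρ * y) * (1 + mobParam ρ) := by
    have h2 : 0 < 1 - ρ := by linarith [hρ.2]
    unfold mobParam; field_simp; ring
  rw [e, Real.log_mul (by positivity) (by positivity), Real.log_div (by positivity) (by positivity)]

lemma row_sum_eq' {ρ y c : ℝ} (hρ : ρ ∈ Ioo (0 : ℝ) 1) (hy : 0 ≤ y) (hc : 0 ≤ c) :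
    c * Real.log (c / ((1 - ρ) / 4 + (1 + ρ) / 4 * y)) =
      c * (Real.log (2 * c) - (Real.log (mob (mobParam ρ) y) + Real.log (1 + mobParam ρ * y))
        + Real.log (1 + mobParam ρ)) := by
  have hk := mobParam_pos hρ
  have hM := mob_pos hk hy
  rcases hc.eq_or_lt with rfl | hc
  · simp
  have h1 : 0 < 1 + ρ := by linarith [hρ.1]
  have e : c / ((1 - ρ) / 4 + (1 + ρ) / 4 * y) =
      2 * c / (mob (mobParam ρ) y * (1 + mobParam ρ * y)) * (1 + mobParam ρ) := by
    have h2 : 0 < 1 - ρ := by linarith [hρ.2]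
    unfold mob mobParam; field_simp; ring
  rw [e, Real.log_mul (by positivity) (by positivity), Real.log_div (by positivity) (by positivity),
    Real.log_mul (x := mob _ _) (by positivity) (by positivity)]

/-- Weak duality: every tilt `(1, y)` bounds the relative entropy of every coupling from below. -/
lemma le_D2ab_mul_log {ρ a b p y : ℝ} (hρ : ρ ∈ Ioo (0 : ℝ) 1) (ha : 0 ≤ a) (ha1 : a ≤ 1)
    (hp : p ∈ Icc (max 0 (a + b - 1)) (min a b)) (hy : 0 ≤ y) (h : y = 0 → b = 0) :
    klHalf a + b * Real.log y - (Real.log (1 + mobParam ρ * y) - Real.log (1 + mobParam ρ)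
      + a * Real.log (mob (mobParam ρ) y)) ≤ D2ab ρ a b p * Real.log 2 := by
  obtain ⟨hp1, hp2⟩ := hp
  rw [max_le_iff] at hp1
  rw [le_min_iff] at hp2
  have h1 : 0 < (1 + ρ) / 4 := by linarith [hρ.1]
  have h2 : 0 < (1 - ρ) / 4 := by linarith [hρ.2]
  -- One log-sum inequality per row of the coupling; up to a constant, the row normalisers are the
  -- values of the noise operator at `(1, y)`.
  have r0 := log_sum_le (u := 1 + p - a - b) (v := b - p) (by linarith) (by linarith) h1 h2 hy
    fun h0 => by linarith [h h0]
  have r1 := log_sum_le (u := a - p) (v := p) (by linarith) (by linarith) h2 h1 hy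
    fun h0 => by linarith [h h0]
  rw [show 1 + p - a - b + (b - p) = 1 - a by ring, row_sum_eq hρ hy (by linarith)] at r0
  rw [sub_add_cancel, row_sum_eq' hρ hy ha] at r1
  rw [D2ab_mul_log]
  unfold klHalf
  linarith

lemma log_sum_eq {α β y c : ℝ} (hα : 0 < α) (hβ : 0 < β) (hy : 0 ≤ y) (hc : 0 ≤ c) :
    α * c * Real.log (α * c / α) + β * y * c * Real.log (β * y * c / β) =
      (α * c + β * y * c) * Real.log ((α * c + β * y * c) / (α + β * y))
        + β * y * c * Real.log y := by
  have e1 : α * c / α = c := by field_simp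
  have e2 : β * y * c / β = y * c := by field_simp
  have e3 : (α * c + β * y * c) / (α + β * y) = c := by field_simp
  rw [e1, e2, e3]
  rcases hc.eq_or_lt with rfl | hc
  · simp
  rcases hy.eq_or_lt with rfl | hy
  · simp
  rw [Real.log_mul hy.ne' hc.ne']; ring

lemma mem_Icc_tilt {k a y : ℝ} (hk : 0 < k) (ha : 0 ≤ a) (ha1 : a ≤ 1) (hy : 0 ≤ y) :
    a * (y / (k + y)) ∈ Icc (max 0 (a + tiltMarg k a y - 1)) (min a (tiltMarg k a y)) := by
  have h1 : 0 ≤ 1 - a := sub_nonneg.2 ha1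
  have h2 : y / (k + y) ≤ 1 := by rw [div_le_one (by positivity)]; linarith
  have h3 : k * y / (1 + k * y) ≤ 1 := by rw [div_le_one (by positivity)]; linarith
  unfold tiltMarg
  refine ⟨max_le (by positivity) ?_, le_min ?_ ?_⟩
  · nlinarith
  · nlinarith
  · have : 0 ≤ (1 - a) * (k * y / (1 + k * y)) := by positivity
    linarith

/-- The tilted coupling attains the bound `le_D2ab_mul_log`. -/
lemma D2ab_tilt_mul_log {ρ a y : ℝ} (hρ : ρ ∈ Ioo (0 : ℝ) 1) (ha : 0 ≤ a) (ha1 : a ≤ 1)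
    (hy : 0 ≤ y) :
    D2ab ρ a (tiltMarg (mobParam ρ) a y) (a * (y / (mobParam ρ + y))) * Real.log 2 =
      klHalf a + tiltMarg (mobParam ρ) a y * Real.log y - (Real.log (1 + mobParam ρ * y)
        - Real.log (1 + mobParam ρ) + a * Real.log (mob (mobParam ρ) y)) := by
  have hk := mobParam_pos hρ
  have h1 : 0 < 1 + ρ := by linarith [hρ.1]
  have h2 : 0 < 1 - ρ := by linarith [hρ.2]
  have ha2 : 0 ≤ 1 - a := sub_nonneg.2 ha1
  have r0 := log_sum_eq (α := (1 + ρ) / 4) (β := (1 - ρ) / 4)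
    (c := 2 * (1 - a) * (1 + mobParam ρ) / (1 + mobParam ρ * y)) (by positivity) (by positivity) hy
    (by positivity)
  have r1 := log_sum_eq (α := (1 - ρ) / 4) (β := (1 + ρ) / 4)
    (c := 2 * a * (1 + mobParam ρ) / (mobParam ρ + y)) (by positivity) (by positivity) hy
    (by positivity)
  have hρk : mobParam ρ * (1 + ρ) = 1 - ρ := by unfold mobParam; field_simp
  have hρ1 : 1 + ρ = 2 / (1 + mobParam ρ) := by
    rw [eq_div_iff (by positivity)]; linear_combination hρk
  have e00 : (1 + ρ) / 4 * (2 * (1 - a) * (1 + mobParam ρ) / (1 + mobParam ρ * y)) =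
      1 + a * (y / (mobParam ρ + y)) - a - tiltMarg (mobParam ρ) a y := by
    unfold tiltMarg
    rw [hρ1]
    field_simp
    ring
  have e01 : (1 - ρ) / 4 * y * (2 * (1 - a) * (1 + mobParam ρ) / (1 + mobParam ρ * y)) =
      tiltMarg (mobParam ρ) a y - a * (y / (mobParam ρ + y)) := by
    unfold tiltMarg
    rw [← hρk, hρ1]
    field_simp
    ring
  have e10 : (1 - ρ) / 4 * (2 * a * (1 + mobParam ρ) / (mobParam ρ + y)) =
      a - a * (y / (mobParam ρ + y)) := by
    rw [← hρk, hρ1]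
    field_simp
    ring
  have e11 : (1 + ρ) / 4 * y * (2 * a * (1 + mobParam ρ) / (mobParam ρ + y)) =
      a * (y / (mobParam ρ + y)) := by
    rw [hρ1]
    field_simp
    ring
  rw [e00, e01, show 1 + a * (y / (mobParam ρ + y)) - a - tiltMarg (mobParam ρ) a y +
    (tiltMarg (mobParam ρ) a y - a * (y / (mobParam ρ + y))) = 1 - a by ring,
    row_sum_eq hρ hy ha2] at r0
  rw [e10, e11, sub_add_cancel, row_sum_eq' hρ hy ha] at r1
  rw [D2ab_mul_log, r0, r1]
  unfold klHalf
  ring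

lemma Icc_coupling_nonempty {a b : ℝ} (ha : 0 ≤ a) (ha1 : a ≤ 1) (hb : 0 ≤ b) (hb1 : b ≤ 1) :
    (Icc (max 0 (a + b - 1)) (min a b)).Nonempty :=
  nonempty_Icc.2 (max_le (le_min ha hb) (le_min (by linarith) (by linarith)))

lemma le_DD2_mul_log {ρ a b y : ℝ} (hρ : ρ ∈ Ioo (0 : ℝ) 1) (ha : 0 ≤ a) (ha1 : a ≤ 1)
    (hb : 0 ≤ b) (hb1 : b ≤ 1) (hy : 0 ≤ y) (h : y = 0 → b = 0) :
    klHalf a + b * Real.log y - (Real.log (1 + mobParam ρ * y) - Real.log (1 + mobParam ρ)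
      + a * Real.log (mob (mobParam ρ) y)) ≤ DD2 ρ a b * Real.log 2 := by
  have hl := Real.log_pos one_lt_two
  rw [← div_le_iff₀ hl]
  refine le_csInf ((Icc_coupling_nonempty ha ha1 hb hb1).image _) ?_
  rintro _ ⟨p, hp, rfl⟩
  rw [div_le_iff₀ hl]
  exact le_D2ab_mul_log hρ ha ha1 hp hy h

lemma bddBelow_D2ab {ρ a b : ℝ} (hρ : ρ ∈ Ioo (0 : ℝ) 1) (ha : 0 ≤ a) (ha1 : a ≤ 1) :
    BddBelow ((fun p => D2ab ρ a b p) '' Icc (max 0 (a + b - 1)) (min a b)) := by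
  have hl := Real.log_pos one_lt_two
  refine ⟨klHalf a / Real.log 2, ?_⟩
  rintro _ ⟨p, hp, rfl⟩
  rw [div_le_iff₀ hl]
  simpa [mob_one (mobParam_pos hρ)] using
    le_D2ab_mul_log hρ ha ha1 hp zero_le_one (fun h => absurd h one_ne_zero)

lemma DD2_tilt_mul_log_le {ρ a y : ℝ} (hρ : ρ ∈ Ioo (0 : ℝ) 1) (ha : 0 ≤ a) (ha1 : a ≤ 1)
    (hy : 0 ≤ y) :
    DD2 ρ a (tiltMarg (mobParam ρ) a y) * Real.log 2 ≤
      klHalf a + tiltMarg (mobParam ρ) a y * Real.log y - (Real.log (1 + mobParam ρ * y)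
        - Real.log (1 + mobParam ρ) + a * Real.log (mob (mobParam ρ) y)) := by
  rw [← D2ab_tilt_mul_log hρ ha ha1 hy]
  exact mul_le_mul_of_nonneg_right (csInf_le (bddBelow_D2ab hρ ha ha1)
    (mem_image_of_mem _ (mem_Icc_tilt (mobParam_pos hρ) ha ha1 hy))) (Real.log_pos one_lt_two).le

lemma DD2_comm (ρ a b : ℝ) : DD2 ρ a b = DD2 ρ b a := by
  have hl := (Real.log_pos one_lt_two).ne'
  unfold DD2
  rw [add_comm b a, min_comm b a]
  congr 1
  refine image_congr fun p _ => mul_right_cancel₀ hl ?_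
  rw [D2ab_mul_log, D2ab_mul_log, show 1 + p - a - b = 1 + p - b - a by ring]
  ring

/-- Flipping both bits preserves `P_XY` and sends `p` to `1 + p - a - b`. -/
lemma DD2_one_sub (ρ a b : ℝ) : DD2 ρ (1 - a) (1 - b) = DD2 ρ a b := by
  have hl := (Real.log_pos one_lt_two).ne'
  have key : ∀ a b : ℝ, (fun p => D2ab ρ a b p) '' Icc (max 0 (a + b - 1)) (min a b) ⊆
      (fun p => D2ab ρ (1 - a) (1 - b) p) ''
        Icc (max 0 (1 - a + (1 - b) - 1)) (min (1 - a) (1 - b)) := by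
    rintro a b _ ⟨p, ⟨hp1, hp2⟩, rfl⟩
    rw [max_le_iff] at hp1
    rw [le_min_iff] at hp2
    refine ⟨1 + p - a - b, ⟨max_le ?_ ?_, le_min ?_ ?_⟩, mul_right_cancel₀ hl ?_⟩
    any_goals linarith
    simp only
    rw [D2ab_mul_log, D2ab_mul_log,
      show 1 + (1 + p - a - b) - (1 - a) - (1 - b) = p by ring,
      show 1 - b - (1 + p - a - b) = a - p by ring, show 1 - a - (1 + p - a - b) = b - p by ring]
    ring
  refine congrArg sInf (Subset.antisymm ?_ (key a b))
  simpa using key (1 - a) (1 - b)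

lemma klHalf_le_DD2 {ρ a b : ℝ} (hρ : ρ ∈ Ioo (0 : ℝ) 1) (ha : 0 ≤ a) (ha1 : a ≤ 1)
    (hb : 0 ≤ b) (hb1 : b ≤ 1) : klHalf b ≤ DD2 ρ a b * Real.log 2 := by
  rw [DD2_comm]
  simpa [mob_one (mobParam_pos hρ)] using
    le_DD2_mul_log hρ hb hb1 ha ha1 zero_le_one (fun h => absurd h one_ne_zero)

/-! ### The inverse of the binary entropy function -/

lemma H2_eq (t : ℝ) : H2 t = Real.binEntropy t / Real.log 2 := by
  simp only [H2, Real.binEntropy, Real.logb, Real.log_inv]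
  ring

lemma klHalf_eq_H2 (t : ℝ) : klHalf t = (1 - H2 t) * Real.log 2 := by
  have hl := (Real.log_pos one_lt_two).ne'
  have e : ∀ x : ℝ, x * Real.log (2 * x) = x * Real.log 2 + x * Real.log x := fun x => by
    rcases eq_or_ne x 0 with rfl | hx
    · simp
    rw [Real.log_mul two_ne_zero hx]; ring
  unfold klHalf H2
  rw [e, e]
  simp only [Real.logb]
  field_simp
  ring

lemma H2_injOn : InjOn H2 (Icc 0 (1 / 2)) := by
  have hl := (Real.log_pos one_lt_two).ne'
  intro x hx y hy hxy
  rw [H2_eq, H2_eq, div_left_inj' hl] at hxy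
  rw [one_div] at hx hy
  exact Real.binEntropy_strictMonoOn.injOn hx hy hxy

lemma H2_surjOn : SurjOn H2 (Icc 0 (1 / 2)) (Icc 0 1) := by
  have hl := (Real.log_pos one_lt_two).ne'
  have hc : ContinuousOn H2 (Icc 0 (1 / 2)) := by
    rw [funext H2_eq]
    exact (Real.binEntropy_continuous.div_const _).continuousOn
  have := intermediate_value_Icc (by norm_num : (0 : ℝ) ≤ 1 / 2) hc
  have h0 : H2 0 = 0 := by simp [H2_eq]
  have h1 : H2 (1 / 2) = 1 := by rw [H2_eq, one_div, Real.binEntropy_two_inv, div_self hl]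
  rwa [h0, h1] at this

lemma D2inv_mem {s : ℝ} (hs : s ∈ Icc (0 : ℝ) 1) : D2inv s ∈ Icc (0 : ℝ) (1 / 2) :=
  Function.invFunOn_mem (H2_surjOn ⟨sub_nonneg.2 hs.2, by linarith [hs.1]⟩)

/-- This is what makes bounds affine in `klHalf` affine in `s`. -/
lemma klHalf_D2inv {s : ℝ} (hs : s ∈ Icc (0 : ℝ) 1) : klHalf (D2inv s) = s * Real.log 2 := by
  have h := D2inv_mem hs
  have e : H2 (D2inv s) = 1 - s :=
    Function.invFunOn_eq (H2_surjOn ⟨sub_nonneg.2 hs.2, by linarith [hs.1]⟩)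
  rw [klHalf_eq_H2, e, sub_sub_cancel]

lemma exists_D2inv_eq {b : ℝ} (hb : b ∈ Icc (0 : ℝ) (1 / 2)) :
    ∃ t ∈ Icc (0 : ℝ) 1, D2inv t = b := by
  have hl := Real.log_pos one_lt_two
  refine ⟨1 - H2 b, ?_, ?_⟩
  · have h1 : H2 b ≤ 1 := by
      rw [H2_eq, div_le_one hl]; exact Real.binEntropy_le_log_two
    have h0 : 0 ≤ H2 b := by
      rw [H2_eq]; exact div_nonneg (Real.binEntropy_nonneg hb.1 (by linarith [hb.2])) hl.le
    exact ⟨by linarith, by linarith⟩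
  · unfold D2inv H2inv
    rw [sub_sub_cancel]
    exact H2_injOn.leftInvOn_invFunOn hb

lemma D2inv_mem_Ioo {s : ℝ} (hs : s ∈ Ioo (0 : ℝ) 1) : D2inv s ∈ Ioo (0 : ℝ) (1 / 2) := by
  have h := D2inv_mem (Ioo_subset_Icc_self hs)
  have e := klHalf_D2inv (Ioo_subset_Icc_self hs)
  have hl := Real.log_pos one_lt_two
  refine ⟨h.1.lt_of_ne fun h0 => ?_, h.2.lt_of_ne fun h0 => ?_⟩
  · rw [← h0] at e
    simp only [klHalf, mul_zero, zero_mul, sub_zero, mul_one, zero_add, one_mul] at e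
    nlinarith [hs.2]
  · rw [h0] at e
    norm_num [klHalf] at e
    linarith [hs.1]

/-! ### Convexity on the unit interval from supporting lines -/

/-- A proper convex combination of distinct points is interior, so no support or continuity is
needed at the endpoints. -/
lemma convexOn_Icc_of_support {f : ℝ → ℝ}
    (h : ∀ x ∈ Ioo (0 : ℝ) 1, ∃ c, ∀ y ∈ Icc (0 : ℝ) 1, f x + c * (y - x) ≤ f y) :
    ConvexOn ℝ (Icc 0 1) f := by
  refine convexOn_iff_pairwise_pos.2 ⟨convex_Icc 0 1, ?_⟩
  intro x hx y hy hxy a b ha hb hab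
  obtain rfl : b = 1 - a := by linarith
  simp only [smul_eq_mul]
  have hz : a * x + (1 - a) * y ∈ Ioo (0 : ℝ) 1 := by
    rcases lt_or_gt_of_ne hxy with hlt | hlt <;>
    constructor <;>
    nlinarith [hx.1, hx.2, hy.1, hy.2, mul_pos ha (sub_pos.2 hlt), mul_pos hb (sub_pos.2 hlt)]
  obtain ⟨c, hc⟩ := h _ hz
  have h1 := mul_le_mul_of_nonneg_left (hc x hx) ha.le
  have h2 := mul_le_mul_of_nonneg_left (hc y hy) hb.le
  linarith

lemma concaveOn_Icc_of_support {f : ℝ → ℝ}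
    (h : ∀ x ∈ Ioo (0 : ℝ) 1, ∃ c, ∀ y ∈ Icc (0 : ℝ) 1, f y ≤ f x + c * (y - x)) :
    ConcaveOn ℝ (Icc 0 1) f := by
  rw [← neg_convexOn_iff]
  refine convexOn_Icc_of_support fun x hx => ?_
  obtain ⟨c, hc⟩ := h x hx
  refine ⟨-c, fun y hy => ?_⟩
  have := hc y hy
  simp only [Pi.neg_apply]
  linarith

/-- The running supremum of a bounded concave function is concave. -/
lemma ConcaveOn.sSup_image_Icc {f : ℝ → ℝ} (hf : ConcaveOn ℝ (Icc 0 1) f)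
    (hb : BddAbove (f '' Icc 0 1)) : ConcaveOn ℝ (Icc 0 1) (fun α => sSup (f '' Icc 0 α)) := by
  refine ⟨convex_Icc 0 1, ?_⟩
  intro x hx y hy a b ha hb' hab
  simp only [smul_eq_mul]
  have hz := (convex_Icc (0 : ℝ) 1) hx hy ha hb' hab
  simp only [smul_eq_mul] at hz
  have hbd : ∀ z ∈ Icc (0 : ℝ) 1, BddAbove (f '' Icc 0 z) := fun z hz =>
    hb.mono (image_mono (Icc_subset_Icc_right hz.2))
  have hne : ∀ z ∈ Icc (0 : ℝ) 1, (f '' Icc 0 z).Nonempty := fun z hz =>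
    (nonempty_Icc.2 hz.1).image f
  have key : ∀ u ∈ Icc 0 x, ∀ v ∈ Icc 0 y, a * f u + b * f v ≤ sSup (f '' Icc 0 (a * x + b * y)) := by
    intro u hu v hv
    have hu1 : u ∈ Icc (0 : ℝ) 1 := ⟨hu.1, hu.2.trans hx.2⟩
    have hv1 : v ∈ Icc (0 : ℝ) 1 := ⟨hv.1, hv.2.trans hy.2⟩
    refine (hf.2 hu1 hv1 ha hb' hab).trans (le_csSup (hbd _ hz) (mem_image_of_mem f ?_))
    have := hu.1; have := hv.1; have := hu.2; have := hv.2
    simp only [smul_eq_mul]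
    exact ⟨by positivity, by gcongr⟩
  refine le_of_forall_pos_le_add fun ε hε => ?_
  obtain ⟨_, ⟨u, hu, rfl⟩, hu'⟩ := exists_lt_of_lt_csSup (hne x hx) (sub_lt_self _ hε)
  obtain ⟨_, ⟨v, hv, rfl⟩, hv'⟩ := exists_lt_of_lt_csSup (hne y hy) (sub_lt_self _ hε)
  have h1 := mul_le_mul_of_nonneg_left hu'.le ha
  have h2 := mul_le_mul_of_nonneg_left hv'.le hb'
  have h3 := key u hu v hv
  have h4 : a * ε + b * ε = ε := by rw [← add_mul, hab, one_mul]
  linarith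

/-! ### Duality bounds in terms of the noise operator -/

section Duality

variable {ρ q a b y : ℝ}

/-- Stationarity makes the marginal of the tilted coupling agree with the Gibbs optimiser for `y ^
q`, so the Gibbs step is an equality. -/
lemma DD2_sub_le_of_stationary (hρ : ρ ∈ Ioo (0 : ℝ) 1) (hq : q ≠ 0) (ha : 0 ≤ a) (ha1 : a ≤ 1)
    (hy : 0 < y) (h : tiltMarg (mobParam ρ) a y = y ^ q / (1 + y ^ q)) :
    DD2 ρ a (y ^ q / (1 + y ^ q)) * Real.log 2 - klHalf (y ^ q / (1 + y ^ q)) / q ≤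
      klHalf a - noiseLog (mobParam ρ) q a y := by
  have h1 := DD2_tilt_mul_log_le hρ ha ha1 hy.le
  have h2 := klHalf_eq (w := y ^ q) (by positivity)
  rw [Real.log_rpow hy] at h2
  rw [h] at h1
  rw [h2]
  generalize y ^ q / (1 + y ^ q) = c at *
  have e : (c * (q * Real.log y) - Real.log ((1 + y ^ q) / 2)) / q =
      c * Real.log y - 1 / q * Real.log ((1 + y ^ q) / 2) := by field_simp
  rw [e]
  unfold noiseLog
  linarith

/-- Here `b` is the Gibbs optimiser for `y ^ q`, so only weak duality is lossy and the sign of `q`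
plays no role for `y > 0`. -/
lemma le_DD2_sub_of_marginal (hρ : ρ ∈ Ioo (0 : ℝ) 1) (hq : q ≠ 0) (ha : 0 ≤ a) (ha1 : a ≤ 1)
    (hy : 0 ≤ y) (hyq : y = 0 → 0 < q) :
    klHalf a - noiseLog (mobParam ρ) q a y ≤
      DD2 ρ a (y ^ q / (1 + y ^ q)) * Real.log 2 - klHalf (y ^ q / (1 + y ^ q)) / q := by
  have hb1 : y ^ q / (1 + y ^ q) ≤ 1 := by rw [div_le_one (by positivity)]; linarith
  have h1 := le_DD2_mul_log (b := y ^ q / (1 + y ^ q)) hρ ha ha1 (by positivity) hb1 hy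
    fun h0 => by rw [h0, Real.zero_rpow hq]; simp
  have h2 := klHalf_eq (w := y ^ q) (by positivity)
  have h3 : y ^ q / (1 + y ^ q) * Real.log (y ^ q) =
      y ^ q / (1 + y ^ q) * (q * Real.log y) := by
    rcases hy.eq_or_lt with rfl | hy
    · rw [Real.zero_rpow hq]; simp
    · rw [Real.log_rpow hy]
  rw [h3] at h2
  rw [h2]
  generalize y ^ q / (1 + y ^ q) = c at *
  have e : (c * (q * Real.log y) - Real.log ((1 + y ^ q) / 2)) / q =
      c * Real.log y - 1 / q * Real.log ((1 + y ^ q) / 2) := by field_simp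
  rw [e]
  unfold noiseLog
  linarith

lemma exists_le_DD2_sub (hρ : ρ ∈ Ioo (0 : ℝ) 1) (hq : 0 < q) (ha : 0 ≤ a) (ha1 : a ≤ 1)
    (hb : 0 ≤ b) (hb1 : b ≤ 1 / 2) :
    ∃ y, 0 ≤ y ∧ y ≤ 1 ∧ klHalf a - noiseLog (mobParam ρ) q a y ≤
      DD2 ρ a b * Real.log 2 - klHalf b / q := by
  have hb2 : 0 < 1 - b := by linarith
  have hw : b / (1 - b) ≤ 1 := by rw [div_le_one hb2]; linarith
  have e : ((b / (1 - b)) ^ (1 / q)) ^ q = b / (1 - b) := by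
    rw [← Real.rpow_mul (by positivity), one_div_mul_cancel hq.ne', Real.rpow_one]
  -- This tilt makes `b` the Gibbs optimiser.
  refine ⟨(b / (1 - b)) ^ (1 / q), by positivity,
    Real.rpow_le_one (by positivity) hw (by positivity), ?_⟩
  have := le_DD2_sub_of_marginal (y := (b / (1 - b)) ^ (1 / q)) hρ hq.ne' ha ha1 (by positivity)
    fun _ => hq
  rw [e] at this
  have e2 : b / (1 - b) / (1 + b / (1 - b)) = b := by field_simp; ring
  rwa [e2] at this

/-- Dividing Gibbs' inequality by `q < 0` aligns it with weak duality, so the bound holds for every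
tilt. -/
lemma le_DD2_sub_of_neg (hρ : ρ ∈ Ioo (0 : ℝ) 1) (hq : q < 0) (ha : 0 ≤ a) (ha1 : a ≤ 1)
    (hb : 0 ≤ b) (hb1 : b ≤ 1) (hy : 0 < y) :
    klHalf a - noiseLog (mobParam ρ) q a y ≤ DD2 ρ a b * Real.log 2 - klHalf b / q := by
  have h1 := le_DD2_mul_log hρ ha ha1 hb hb1 hy.le fun h0 => absurd h0 hy.ne'
  have h2 := klHalf_ge hb hb1 (w := y ^ q) (by positivity) fun h0 => absurd h0 (by positivity)
  rw [Real.log_rpow hy] at h2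
  have h3 := div_le_div_of_nonpos_of_le hq.le h2
  have hq0 := hq.ne
  have e : (b * (q * Real.log y) - Real.log ((1 + y ^ q) / 2)) / q =
      b * Real.log y - 1 / q * Real.log ((1 + y ^ q) / 2) := by field_simp
  rw [e] at h3
  unfold noiseLog
  linarith

/-- As `1 / 2 ≤ a`, the tilted marginals for `y ∈ [0, 1]` reach every `b ≤ 1 / 2`. -/
lemma exists_DD2_sub_le (hρ : ρ ∈ Ioo (0 : ℝ) 1) (hq : 0 < q) (ha : 1 / 2 ≤ a) (ha1 : a ≤ 1)
    (hb : 0 ≤ b) (hb1 : b ≤ 1 / 2) :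
    ∃ y, 0 ≤ y ∧ y ≤ 1 ∧ DD2 ρ a b * Real.log 2 - klHalf b / q ≤
      klHalf a - noiseLog (mobParam ρ) q a y := by
  have hk := mobParam_pos hρ
  have hk1 := mobParam_lt_one hρ
  have hc := (continuousOn_tiltMarg hk a).mono (fun x (hx : x ∈ Icc (0 : ℝ) 1) => hx.1)
  have h0 : tiltMarg (mobParam ρ) a 0 = 0 := by simp [tiltMarg]
  have h1 : 1 / 2 ≤ tiltMarg (mobParam ρ) a 1 := by
    rw [tiltMarg_one hk, div_le_div_iff₀ (by positivity) (by positivity)]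
    nlinarith
  obtain ⟨y, hy, hyb⟩ := intermediate_value_Icc zero_le_one hc
    (show b ∈ Icc (tiltMarg (mobParam ρ) a 0) (tiltMarg (mobParam ρ) a 1) from
      ⟨by rw [h0]; exact hb, hb1.trans h1⟩)
  refine ⟨y, hy.1, hy.2, ?_⟩
  have hy0 := hy.1
  have h2 := DD2_tilt_mul_log_le hρ (by linarith) ha1 hy0
  have hyb : tiltMarg (mobParam ρ) a y = b := hyb
  rw [hyb] at h2
  have hb0 : y = 0 → b = 0 := by rintro rfl; rw [← hyb, h0]
  have h3 := klHalf_ge hb (by linarith) (w := y ^ q) (by positivity) fun h =>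
    hb0 ((Real.rpow_eq_zero hy0 hq.ne').1 h)
  have h4 : b * Real.log (y ^ q) = b * (q * Real.log y) := by
    rcases hy0.eq_or_lt with h | h
    · rw [hb0 h.symm]; simp
    · rw [Real.log_rpow h]
  rw [h4] at h3
  have h5 := div_le_div_of_nonneg_right h3 hq.le
  have e : (b * (q * Real.log y) - Real.log ((1 + y ^ q) / 2)) / q =
      b * Real.log y - 1 / q * Real.log ((1 + y ^ q) / 2) := by field_simp
  rw [e] at h5
  unfold noiseLog
  linarith

end Duality

/-! ### The envelopes -/

section Envelopes

variable {ρ q s t : ℝ}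

lemma phi_sub_mul_log (ht : t ∈ Icc (0 : ℝ) 1) : (phi ρ s t - t / q) * Real.log 2 =
    DD2 ρ (D2inv s) (D2inv t) * Real.log 2 - klHalf (D2inv t) / q := by
  rw [klHalf_D2inv ht, phi]; ring

lemma phi_sub_mul_log' (ht : t ∈ Icc (0 : ℝ) 1) : (phi ρ s t - t / q) * Real.log 2 =
    DD2 ρ (1 - D2inv s) (1 - D2inv t) * Real.log 2 - klHalf (1 - D2inv t) / q := by
  rw [klHalf_symm, DD2_one_sub, phi_sub_mul_log ht]

lemma psi_sub_mul_log (ht : t ∈ Icc (0 : ℝ) 1) : (psi ρ s t - t / q) * Real.log 2 =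
    DD2 ρ (1 - D2inv s) (D2inv t) * Real.log 2 - klHalf (D2inv t) / q := by
  rw [klHalf_D2inv ht, psi, ← DD2_one_sub, sub_sub_cancel]; ring

lemma le_phi (hρ : ρ ∈ Ioo (0 : ℝ) 1) (hs : s ∈ Icc (0 : ℝ) 1) (ht : t ∈ Icc (0 : ℝ) 1) :
    t ≤ phi ρ s t := by
  have ha := D2inv_mem hs
  have hb := D2inv_mem ht
  have := klHalf_le_DD2 hρ ha.1 (by linarith [ha.2]) hb.1 (by linarith [hb.2])
  rw [klHalf_D2inv ht] at this
  exact le_of_mul_le_mul_right this (Real.log_pos one_lt_two)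

lemma bddBelow_phi_sub (hρ : ρ ∈ Ioo (0 : ℝ) 1) (hs : s ∈ Icc (0 : ℝ) 1) :
    BddBelow ((fun t => phi ρ s t - t / q) '' Icc 0 1) := by
  refine ⟨-|1 / q|, ?_⟩
  rintro _ ⟨t, ht, rfl⟩
  have h1 := le_phi hρ hs ht
  have h2 : t / q ≤ |1 / q| := by
    rw [div_eq_mul_one_div]
    calc t * (1 / q) ≤ t * |1 / q| := mul_le_mul_of_nonneg_left (le_abs_self _) ht.1
      _ ≤ |1 / q| := mul_le_of_le_one_left (abs_nonneg _) ht.2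
  simp only
  linarith [ht.1]

lemma phiQ_le (hρ : ρ ∈ Ioo (0 : ℝ) 1) (hs : s ∈ Icc (0 : ℝ) 1) (ht : t ∈ Icc (0 : ℝ) 1) :
    phiQ ρ q s ≤ phi ρ s t - t / q :=
  csInf_le (bddBelow_phi_sub hρ hs) (mem_image_of_mem _ ht)

lemma le_phiQ {m : ℝ} (h : ∀ t ∈ Icc (0 : ℝ) 1, m ≤ phi ρ s t - t / q) : m ≤ phiQ ρ q s :=
  le_csInf ((nonempty_Icc.2 zero_le_one).image _) (forall_mem_image.2 h)

lemma psiQ_le {m : ℝ} (h : ∀ t ∈ Icc (0 : ℝ) 1, psi ρ s t - t / q ≤ m) : psiQ ρ q s ≤ m :=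
  csSup_le ((nonempty_Icc.2 zero_le_one).image _) (forall_mem_image.2 h)

lemma phiQ_support_of_one_lt (hρ : ρ ∈ Ioo (0 : ℝ) 1) (hq : 1 < q) {s₀ : ℝ}
    (hs₀ : s₀ ∈ Ioo (0 : ℝ) 1) :
    ∃ c, ∀ s ∈ Icc (0 : ℝ) 1, phiQ ρ q s₀ + c * (s - s₀) ≤ phiQ ρ q s := by
  have hl := Real.log_pos one_lt_two
  have hk := mobParam_pos hρ
  have hk1 := mobParam_lt_one hρ
  have hs₀' := Ioo_subset_Icc_self hs₀
  have ha₀ := D2inv_mem_Ioo hs₀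
  obtain ⟨y₀, c, hy, hy1, hst, hsup⟩ := noiseLog_support_of_one_lt hk hk1 hq ha₀.1 ha₀.2
  refine ⟨1 - c, fun s hs => le_phiQ fun t ht => ?_⟩
  have ha := D2inv_mem hs
  have hb := D2inv_mem ht
  have hu := Real.rpow_le_one hy.le hy1.le (by linarith : 0 ≤ q)
  have hu0 : 0 < y₀ ^ q := by positivity
  obtain ⟨t₀, ht₀, hbt⟩ := exists_D2inv_eq (b := y₀ ^ q / (1 + y₀ ^ q)) ⟨by positivity, by
    rw [div_le_div_iff₀ (by positivity) (by positivity)]; linarith⟩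
  have h1 := DD2_sub_le_of_stationary hρ (by linarith) ha₀.1.le (by linarith [ha₀.2]) hy hst
  rw [← hbt, ← phi_sub_mul_log ht₀, klHalf_D2inv hs₀'] at h1
  obtain ⟨y, hy0, hy1', h2⟩ := exists_le_DD2_sub hρ (by linarith : 0 < q) ha.1
    (by linarith [ha.2]) hb.1 hb.2
  rw [← phi_sub_mul_log ht, klHalf_D2inv hs] at h2
  have h3 := hsup _ y ha.1 (by linarith [ha.2]) hy0 hy1'
  rw [klHalf_D2inv hs, klHalf_D2inv hs₀'] at h3
  have h4 := mul_le_mul_of_nonneg_right (phiQ_le (q := q) hρ hs₀' ht₀) hl.le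
  refine le_of_mul_le_mul_right ?_ hl
  linarith

lemma phiQ_support_of_neg (hρ : ρ ∈ Ioo (0 : ℝ) 1) (hq : q < 0) {s₀ : ℝ}
    (hs₀ : s₀ ∈ Ioo (0 : ℝ) 1) :
    ∃ c, ∀ s ∈ Icc (0 : ℝ) 1, phiQ ρ q s ≤ phiQ ρ q s₀ + c * (s - s₀) := by
  have hl := Real.log_pos one_lt_two
  have hk := mobParam_pos hρ
  have hk1 := mobParam_lt_one hρ
  have hs₀' := Ioo_subset_Icc_self hs₀
  have ha₀ := D2inv_mem_Ioo hs₀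
  obtain ⟨y₀, c, hy, hy1, hst, hsup⟩ := noiseLog_support_of_lt_one hk hk1 (q := q) (by linarith)
    hq.ne (a₀ := 1 - D2inv s₀) (by linarith [ha₀.2]) (by linarith [ha₀.1])
  refine ⟨1 - c, fun s hs => ?_⟩
  have ha := D2inv_mem hs
  obtain ⟨y, hy0, hy1', hst'⟩ := exists_tiltMarg_eq_of_lt_one (q := q) (a := 1 - D2inv s) hk hk1
    (by linarith) (by linarith [ha.2]) (by linarith [ha.1])
  -- For `q < 0` the optimal second marginal is at least `1 / 2`, so both marginals are reflected to
  -- reach `φ`.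
  have hu := Real.one_le_rpow_of_pos_of_le_one_of_nonpos hy0 hy1' hq.le
  obtain ⟨t, ht, hbt⟩ := exists_D2inv_eq (b := 1 - y ^ q / (1 + y ^ q)) ⟨by
    rw [sub_nonneg, div_le_one (by positivity)]; linarith, by
    have : 1 / 2 ≤ y ^ q / (1 + y ^ q) := by
      rw [div_le_div_iff₀ (by positivity) (by positivity)]; linarith
    linarith⟩
  have h1 := DD2_sub_le_of_stationary hρ hq.ne (by linarith [ha.2]) (by linarith [ha.1]) hy0 hst'
  have hbt' : y ^ q / (1 + y ^ q) = 1 - D2inv t := by linarith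
  rw [hbt', ← phi_sub_mul_log' ht, klHalf_symm, klHalf_D2inv hs] at h1
  have h3 := hsup _ y (by linarith [ha.2]) (by linarith [ha.1] : 1 - D2inv s ≤ 1) hy0.le hy1'
    fun h => absurd h hy0.ne'
  rw [klHalf_symm, klHalf_symm, klHalf_D2inv hs, klHalf_D2inv hs₀'] at h3
  have h4 := mul_le_mul_of_nonneg_right (phiQ_le (q := q) hρ hs ht) hl.le
  suffices h5 : phiQ ρ q s - (1 - c) * (s - s₀) ≤ phiQ ρ q s₀ by linarith
  refine le_phiQ fun t' ht' => ?_
  have hb := D2inv_mem ht'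
  have h2 := le_DD2_sub_of_neg (a := 1 - D2inv s₀) (b := 1 - D2inv t') hρ hq (by linarith [ha₀.2])
    (by linarith [ha₀.1]) (by linarith [hb.2]) (by linarith [hb.1]) hy
  rw [← phi_sub_mul_log' ht', klHalf_symm, klHalf_D2inv hs₀'] at h2
  refine le_of_mul_le_mul_right ?_ hl
  linarith

lemma psiQ_support (hρ : ρ ∈ Ioo (0 : ℝ) 1) (hq : 0 < q) (hq1 : q < 1) {s₀ : ℝ}
    (hs₀ : s₀ ∈ Ioo (0 : ℝ) 1) :
    ∃ c, ∀ s ∈ Icc (0 : ℝ) 1, psiQ ρ q s ≤ psiQ ρ q s₀ + c * (s - s₀) := by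
  have hl := Real.log_pos one_lt_two
  have hk := mobParam_pos hρ
  have hk1 := mobParam_lt_one hρ
  have hs₀' := Ioo_subset_Icc_self hs₀
  have ha₀ := D2inv_mem_Ioo hs₀
  obtain ⟨y₀, c, hy, hy1, hst, hsup⟩ := noiseLog_support_of_lt_one hk hk1 hq1 hq.ne'
    (a₀ := 1 - D2inv s₀) (by linarith [ha₀.2]) (by linarith [ha₀.1])
  have hub : ∀ s ∈ Icc (0 : ℝ) 1, ∀ t ∈ Icc (0 : ℝ) 1, (psi ρ s t - t / q) * Real.log 2 ≤
      s₀ * Real.log 2 - noiseLog (mobParam ρ) q (1 - D2inv s₀) y₀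
        + (1 - c) * (s - s₀) * Real.log 2 := by
    intro s hs t ht
    have ha := D2inv_mem hs
    have hb := D2inv_mem ht
    obtain ⟨y, hy0, hy1', h2⟩ := exists_DD2_sub_le (a := 1 - D2inv s) hρ hq (by linarith [ha.2])
      (by linarith [ha.1]) hb.1 hb.2
    rw [← psi_sub_mul_log ht, klHalf_symm, klHalf_D2inv hs] at h2
    have h3 := hsup _ y (by linarith [ha.2]) (by linarith [ha.1] : 1 - D2inv s ≤ 1) hy0 hy1'
      fun _ => hq
    rw [klHalf_symm, klHalf_symm, klHalf_D2inv hs, klHalf_D2inv hs₀'] at h3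
    linarith
  refine ⟨1 - c, fun s hs => psiQ_le fun t ht => ?_⟩
  have hu := Real.rpow_le_one hy.le hy1.le hq.le
  have hu0 : 0 < y₀ ^ q := by positivity
  obtain ⟨t₀, ht₀, hbt⟩ := exists_D2inv_eq (b := y₀ ^ q / (1 + y₀ ^ q)) ⟨by positivity, by
    rw [div_le_div_iff₀ (by positivity) (by positivity)]; linarith⟩
  have h1 := le_DD2_sub_of_marginal (a := 1 - D2inv s₀) hρ hq.ne' (by linarith [ha₀.2])
    (by linarith [ha₀.1]) hy.le fun _ => hq
  rw [← hbt, ← psi_sub_mul_log ht₀, klHalf_symm, klHalf_D2inv hs₀'] at h1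
  -- The upper bound `hub`, taken at `s = s₀`, also supplies the boundedness that `sSup` needs.
  have hbdd : BddAbove ((fun t => psi ρ s₀ t - t / q) '' Icc 0 1) := by
    refine ⟨(s₀ * Real.log 2 - noiseLog (mobParam ρ) q (1 - D2inv s₀) y₀) / Real.log 2, ?_⟩
    rintro _ ⟨t, ht, rfl⟩
    rw [le_div_iff₀ hl]
    simpa using hub s₀ hs₀' t ht
  have h4 : psi ρ s₀ t₀ - t₀ / q ≤ psiQ ρ q s₀ := le_csSup hbdd (mem_image_of_mem _ ht₀)
  have h5 := mul_le_mul_of_nonneg_right h4 hl.le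
  refine le_of_mul_le_mul_right ?_ hl
  linarith [hub s hs t ht]

/-! ### Convexity and monotonicity for `q ≥ 1`. -/

lemma convexOn_phiQ (hρ : ρ ∈ Ioo (0 : ℝ) 1) (hq : 1 ≤ q) :
    ConvexOn ℝ (Icc 0 1) (phiQ ρ q) := by
  rcases hq.eq_or_lt with rfl | hq
  swap
  · exact convexOn_Icc_of_support fun s₀ hs₀ => phiQ_support_of_one_lt hρ hq hs₀
  -- At `q = 1`, `φ_1` lies within `ε` of the convex function `φ_{1+ε}`.
  refine ⟨convex_Icc 0 1, fun x hx y hy a b ha hb hab => le_of_forall_pos_le_add fun ε hε => ?_⟩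
  have hr : 1 < 1 + ε := by linarith
  have hr0 : 0 < 1 + ε := by linarith
  have hc := (convexOn_Icc_of_support fun s₀ hs₀ =>
    phiQ_support_of_one_lt hρ hr hs₀).2 hx hy ha hb hab
  have hinv : 1 - ε ≤ 1 / (1 + ε) := by rw [le_div_iff₀ hr0]; nlinarith
  have hle : ∀ s ∈ Icc (0 : ℝ) 1, phiQ ρ 1 s ≤ phiQ ρ (1 + ε) s := fun s hs =>
    le_phiQ fun t ht => (phiQ_le hρ hs ht).trans (by
      have : t / (1 + ε) ≤ t / 1 := div_le_div_of_nonneg_left ht.1 one_pos hr.le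
      linarith)
  have hge : ∀ s ∈ Icc (0 : ℝ) 1, phiQ ρ (1 + ε) s - ε ≤ phiQ ρ 1 s := fun s hs =>
    le_phiQ fun t ht => by
      have h1 := phiQ_le (q := 1 + ε) hρ hs ht
      have h2 := mul_le_mul_of_nonneg_left hinv ht.1
      have h3 := mul_le_of_le_one_left hε.le ht.2
      rw [div_eq_mul_one_div] at h1
      linarith
  have h1 := hle _ ((convex_Icc (0 : ℝ) 1) hx hy ha hb hab)
  simp only [smul_eq_mul] at *
  have h2 := mul_le_mul_of_nonneg_left (hge x hx) ha
  have h3 := mul_le_mul_of_nonneg_left (hge y hy) hb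
  have h4 : a * ε + b * ε = ε := by rw [← add_mul, hab, one_mul]
  linarith

lemma phiQ_nonneg (hρ : ρ ∈ Ioo (0 : ℝ) 1) (hq : 1 ≤ q) (hs : s ∈ Icc (0 : ℝ) 1) :
    0 ≤ phiQ ρ q s := le_phiQ fun t ht => by
  have := le_phi hρ hs ht
  have := div_le_self ht.1 hq
  linarith

/-- At `s = t = 0` both marginals are uniform and `P_XY` itself is an admissible coupling. -/
lemma phiQ_zero_nonpos (hρ : ρ ∈ Ioo (0 : ℝ) 1) : phiQ ρ q 0 ≤ 0 := by
  have hk := mobParam_pos hρ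
  have h0 : (0 : ℝ) ∈ Icc (0 : ℝ) 1 := ⟨le_rfl, zero_le_one⟩
  refine (phiQ_le hρ h0 h0).trans ?_
  have hhalf : D2inv 0 = 1 / 2 := by
    obtain ⟨t, ht, h⟩ := exists_D2inv_eq (b := 1 / 2) ⟨by norm_num, le_rfl⟩
    have := klHalf_D2inv ht
    rw [h] at this
    norm_num [klHalf] at this
    rwa [this] at h
  have hb : tiltMarg (mobParam ρ) (1 / 2) 1 = 1 / 2 := by
    rw [tiltMarg_one hk]; field_simp; ring
  have := DD2_tilt_mul_log_le (a := 1 / 2) hρ (by norm_num) (by norm_num) zero_le_one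
  rw [hb, mob_one hk] at this
  norm_num [klHalf] at this
  rw [phi, hhalf, zero_div, sub_zero]
  exact nonpos_of_mul_nonpos_left this (Real.log_pos one_lt_two)

lemma monotoneOn_phiQ (hρ : ρ ∈ Ioo (0 : ℝ) 1) (hq : 1 ≤ q) :
    MonotoneOn (phiQ ρ q) (Icc 0 1) := by
  intro x hx y hy hxy
  have h0 : (0 : ℝ) ∈ Icc (0 : ℝ) 1 := ⟨le_rfl, zero_le_one⟩
  rcases hy.1.eq_or_lt with h | hy0
  · rw [← h] at hxy ⊢
    rw [le_antisymm hxy hx.1]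
  have hxy1 : x / y ≤ 1 := (div_le_one hy0).2 hxy
  have h := (convexOn_phiQ hρ hq).2 h0 hy (sub_nonneg.2 hxy1) (div_nonneg hx.1 hy0.le) (by ring)
  simp only [smul_eq_mul, mul_zero, zero_add, div_mul_cancel₀ x hy0.ne'] at h
  have h1 := mul_nonpos_of_nonneg_of_nonpos (sub_nonneg.2 hxy1) (phiQ_zero_nonpos (q := q) hρ)
  have h2 := mul_le_of_le_one_left (phiQ_nonneg hρ hq hy) hxy1
  linarith

lemma phiTildeQ_eq (hρ : ρ ∈ Ioo (0 : ℝ) 1) (hq : 1 ≤ q) {α : ℝ} (hα : α ∈ Icc (0 : ℝ) 1) :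
    phiTildeQ ρ q α = phiQ ρ q α :=
  IsLeast.csInf_eq ⟨mem_image_of_mem _ ⟨le_rfl, hα.2⟩, forall_mem_image.2 fun _ hs =>
    monotoneOn_phiQ hρ hq hα ⟨hα.1.trans hs.1, hs.2⟩ hs.1⟩

/-! ### Running suprema of functions with supporting lines. -/

lemma bddAbove_image_of_support {f : ℝ → ℝ}
    (h : ∃ c, ∀ y ∈ Icc (0 : ℝ) 1, f y ≤ f (1 / 2) + c * (y - 1 / 2)) :
    BddAbove (f '' Icc 0 1) := by
  obtain ⟨c, hc⟩ := h
  refine ⟨f (1 / 2) + |c|, ?_⟩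
  rintro _ ⟨y, hy, rfl⟩
  have h1 : c * (y - 1 / 2) ≤ |c| := by
    refine (le_abs_self _).trans ?_
    rw [abs_mul]
    refine mul_le_of_le_one_right (abs_nonneg _) (abs_le.2 ⟨?_, ?_⟩) <;> linarith [hy.1, hy.2]
  linarith [hc y hy]

lemma concaveOn_sSup_image_of_support {f : ℝ → ℝ}
    (h : ∀ x ∈ Ioo (0 : ℝ) 1, ∃ c, ∀ y ∈ Icc (0 : ℝ) 1, f y ≤ f x + c * (y - x)) :
    ConcaveOn ℝ (Icc 0 1) (fun α => sSup (f '' Icc 0 α)) :=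
  ConcaveOn.sSup_image_Icc (concaveOn_Icc_of_support h)
    (bddAbove_image_of_support (h (1 / 2) ⟨by norm_num, by norm_num⟩))

end Envelopes

end DSBS

end

theorem mainTheorem4 (ρ : ℝ) (hρ : ρ ∈ Set.Ioo (0 : ℝ) 1) :
    (∀ q : ℝ, 1 ≤ q →
      (∀ α ∈ Set.Icc (0 : ℝ) 1, DSBS.phiTildeQ ρ q α = DSBS.phiQ ρ q α) ∧
      ConvexOn ℝ (Set.Icc (0 : ℝ) 1) (DSBS.phiTildeQ ρ q) ∧
      ConvexOn ℝ (Set.Icc (0 : ℝ) 1) (DSBS.phiQ ρ q)) ∧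
    (∀ q : ℝ, q ∈ Set.Iio (0 : ℝ) ∪ Set.Ioo (0 : ℝ) 1 →
      ConcaveOn ℝ (Set.Icc (0 : ℝ) 1) (DSBS.psiTildeQ ρ q)) := by
  refine ⟨fun q hq => ⟨fun α hα => DSBS.phiTildeQ_eq hρ hq hα, ?_, DSBS.convexOn_phiQ hρ hq⟩, ?_⟩
  · exact (DSBS.convexOn_phiQ hρ hq).congr fun α hα => (DSBS.phiTildeQ_eq hρ hq hα).symm
  · rintro q (hq | hq)
    · have e : DSBS.psiTildeQ ρ q = fun α => sSup (DSBS.phiQ ρ q '' Set.Icc 0 α) :=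
        funext fun α => if_pos hq
      rw [e]
      exact DSBS.concaveOn_sSup_image_of_support fun _ hs => DSBS.phiQ_support_of_neg hρ hq hs
    · have e : DSBS.psiTildeQ ρ q = fun α => sSup (DSBS.psiQ ρ q '' Set.Icc 0 α) :=
        funext fun α => if_neg (not_lt.2 hq.1.le)
      rw [e]
      exact DSBS.concaveOn_sSup_image_of_support fun _ hs => DSBS.psiQ_support hρ hq.1 hq.2 hs
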